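/- Let $[4]=\{1,2,3,4\}$. A \emph{CI couple} $ij|C$ consists of a two-element set $ij=\{i,j\}\subseteq[4]$ and a set $C\subseteq[4]\setminus ij$; sets are written by concatenating their elements, $ij$ stands for $ij|\emptyset$, and $kC=\{k\}\cup C$. Let $\mathcal R(4)$ be the set of all CI couples; a \emph{relation} is a subset of $\mathcal R(4)$. For a relation $\mathcal L$ let \[V_{pd}(\mathcal L)=\{\Sigma\in\mathbb R^{4\times4}\text{ symmetric positive definite}:\ \det(\Sigma_{iC,jC})=0\text{ for all }ij|C\in\mathcal L\}.\] A \emph{Gaussian CI implication} $\mathcal L_1\Rightarrow\mathcal L_2$ is an ordered pair of disjoint relations with $V_{pd}(\mathcal L_1)=V_{pd}(\mathcal L_1\cup\mathcal L_2)$. The \emph{dual} of $ij|C$ is $ij|[4]\setminus ijC$; the dual of a relation, and of a pair of relations, is formed by replacing every couple with its dual. Consider the following pairs. (a) For all distinct $i,j,k\in[4]$ and $C\subseteq[4]\setminus ijk$: \begin{align*} \{ij|C,\ ik|C\}&\Rightarrow\{ij|kC,\ ik|jC\},\\ \{ij|C,\ ik|jC\}&\Rightarrow\{ik|C,\ ij|kC\},\\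 \{ij|kC,\ ik|jC\}&\Rightarrow\{ij|C,\ ik|C\}; \end{align*} and for all distinct $i,j,k,l\in[4]$ and $C\subseteq[4]\setminus ijkl$ (so $C=\emptyset$): \begin{align*} \{ij|C,\ kl|C,\ ik|jlC,\ jl|ikC\}&\Rightarrow\{ik|C\},\\ \{ij|C,\ kl|iC,\ kl|jC,\ ij|klC\}&\Rightarrow\{kl|C\},\\ \{ij|C,\ jl|kC,\ kl|iC,\ ik|jlC\}&\Rightarrow\{ik|C\},\\ \{ij|kC,\ ik|lC,\ il|jC\}&\Rightarrow\{ij|C\},\\ \{ij|kC,\ jk|lC,\ kl|iC,\ il|jC\}&\Rightarrow\{ij|C\}. \end{align*} (b) All pairs obtained by applying a permutation of $[4]$ to one of the 13 pairs \begin{align*} \{23|4, 23|14, 24|1, 34|1\}&\Rightarrow\{23, 23|1, 24|13, 34|12\},\\ \{23, 23|1, 24|1, 34|1\}&\Rightarrow\{23|4, 23|14, 24|13, 34|12\},\\ \{14|2, 14|3, 14|23, 23|14\}&\Rightarrow\{14\},\\ \{14, 14|2, 14|23, 23|14\}&\Rightarrow\{14|3\},\\ \{14, 14|2, 14|3, 23|14\}&\Rightarrow\{14|23\},\\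 \{14, 14|23, 23|1, 23|14\}&\Rightarrow\{14|2, 14|3\},\\ \{14|2, 14|3, 23|1, 23|14\}&\Rightarrow\{14, 14|23\},\\ \{12, 14|3, 14|23, 23|14\}&\Rightarrow\{12|3, 12|4, 12|34, 23|4\},\\ \{12, 14|3, 23|4, 23|14\}&\Rightarrow\{12|3, 12|4, 12|34, 14|23\},\\ \{12|3, 14|2, 23|4, 23|14\}&\Rightarrow\{12, 12|4, 12|34, 14\},\\ \{12|3, 14, 14|2, 23|14\}&\Rightarrow\{12, 12|4, 12|34, 23|4\},\\ \{14|2, 23|1, 23|4, 23|14\}&\Rightarrow\{23\},\\ \{14|2, 23, 23|1, 23|14\}&\Rightarrow\{23|4\}. \end{align*} (c) The duals of all pairs in (b). Then every pair in (a), (b), (c) is a Gaussian CI implication, and every Gaussian CI implication $\mathcal L_1\Rightarrow\mathcal L_2$ on $[4]$ can be deduced from them: each couple in $\mathcal L_2$ is obtained from the couples in $\mathcal L_1$ by finitely many applications of pairs in (a), (b), (c), where a pair $\mathcal K\Rightarrow\mathcal K'$ may be applied once all couples of $\mathcal K$ have been obtained and then yields all couples of $\mathcal K'$. -/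

import Mathlib

namespace GaussianCI

/-- A pair `(ij, C)`, written `ij|C`, of finite subsets of `[m]`.  It is a conditional
independence couple if it belongs to `couples m`. -/
abbrev Couple (m : ℕ) : Type := Finset (Fin m) × Finset (Fin m)

/-- A set of couples; it is a conditional independence relation on `[m]` if it is a subset of
`couples m`. -/
abbrev Relation (m : ℕ) : Type := Finset (Couple m)

/-- The maximal relation `R(m)`: all couples `ij|C` of a two-element set `ij ⊆ [m]` and a set
`C ⊆ [m] \ ij`. -/
def couples (m : ℕ) : Relation m :=
  Finset.univ.filter fun c => c.1.card = 2 ∧ Disjoint c.1 c.2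

/-- The couple `ij|C`. -/
def cpl {m : ℕ} (i j : Fin m) (C : Finset (Fin m)) : Couple m := ({i, j}, C)

/-- The almost-principal determinant `det (S_{iC,jC})`: the rows are indexed by `i` (for `none`)
and the elements of `C`, the columns by `j` (for `none`) and the elements of `C`. -/
def apDet {m : ℕ} (S : Matrix (Fin m) (Fin m) ℝ) (i j : Fin m) (C : Finset (Fin m)) : ℝ :=
  (S.submatrix (fun a : Option C => a.elim i (fun c => (c : Fin m)))
    (fun a : Option C => a.elim j (fun c => (c : Fin m)))).det

/-- The Gaussian conditional independence model `V_pd(L)`: the positive definite matrices `S`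
with `det (S_{iC,jC}) = 0` for all `ij|C ∈ L`. -/
def Vpd {m : ℕ} (L : Relation m) : Set (Matrix (Fin m) (Fin m) ℝ) :=
  {S | S.PosDef ∧ ∀ (i j : Fin m) (C : Finset (Fin m)), cpl i j C ∈ L → apDet S i j C = 0}

/-- The ordered pair `(L₁, L₂)` is a Gaussian conditional independence implication `L₁ ⇒ L₂`. -/
def IsImplication {m : ℕ} (L₁ L₂ : Relation m) : Prop :=
  L₁ ⊆ couples m ∧ L₂ ⊆ couples m ∧ Disjoint L₁ L₂ ∧ Vpd L₁ = Vpd (L₁ ∪ L₂)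

/-- The dual `ij | ([m] \ ijC)` of the couple `ij|C`. -/
def Couple.dual {m : ℕ} (c : Couple m) : Couple m := (c.1, (c.1 ∪ c.2)ᶜ)

/-- The dual of a relation. -/
def Relation.dual {m : ℕ} (L : Relation m) : Relation m := L.image Couple.dual

/-- The relation obtained by applying a permutation of the indices. -/
def Relation.permute {m : ℕ} (σ : Equiv.Perm (Fin m)) (L : Relation m) : Relation m :=
  L.image fun c => (c.1.image σ, c.2.image σ)

/-- The eight general families of implications `L₁ ⇒ L₂`: the three semigaussoid rules, for
distinct `i, j, k` and `C ⊆ [m] \ ijk`, and five further rules, for distinct `i, j, k, l` and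
`C ⊆ [m] \ ijkl`. -/
inductive General {m : ℕ} : Relation m → Relation m → Prop
  | union (i j k : Fin m) (C : Finset (Fin m)) (hd : [i, j, k].Nodup)
      (hC : Disjoint {i, j, k} C) :
      General {cpl i j C, cpl i k C} {cpl i j ({k} ∪ C), cpl i k ({j} ∪ C)}
  | contraction (i j k : Fin m) (C : Finset (Fin m)) (hd : [i, j, k].Nodup)
      (hC : Disjoint {i, j, k} C) :
      General {cpl i j C, cpl i k ({j} ∪ C)} {cpl i k C, cpl i j ({k} ∪ C)}
  | intersection (i j k : Fin m) (C : Finset (Fin m)) (hd : [i, j, k].Nodup)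
      (hC : Disjoint {i, j, k} C) :
      General {cpl i j ({k} ∪ C), cpl i k ({j} ∪ C)} {cpl i j C, cpl i k C}
  | more1 (i j k l : Fin m) (C : Finset (Fin m)) (hd : [i, j, k, l].Nodup)
      (hC : Disjoint {i, j, k, l} C) :
      General {cpl i j C, cpl k l C, cpl i k ({j, l} ∪ C), cpl j l ({i, k} ∪ C)} {cpl i k C}
  | more2 (i j k l : Fin m) (C : Finset (Fin m)) (hd : [i, j, k, l].Nodup)
      (hC : Disjoint {i, j, k, l} C) :
      General {cpl i j C, cpl k l ({i} ∪ C), cpl k l ({j} ∪ C), cpl i j ({k, l} ∪ C)} {cpl k l C}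
  | more3 (i j k l : Fin m) (C : Finset (Fin m)) (hd : [i, j, k, l].Nodup)
      (hC : Disjoint {i, j, k, l} C) :
      General {cpl i j C, cpl j l ({k} ∪ C), cpl k l ({i} ∪ C), cpl i k ({j, l} ∪ C)} {cpl i k C}
  | more4 (i j k l : Fin m) (C : Finset (Fin m)) (hd : [i, j, k, l].Nodup)
      (hC : Disjoint {i, j, k, l} C) :
      General {cpl i j ({k} ∪ C), cpl i k ({l} ∪ C), cpl i l ({j} ∪ C)} {cpl i j C}
  | more5 (i j k l : Fin m) (C : Finset (Fin m)) (hd : [i, j, k, l].Nodup)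
      (hC : Disjoint {i, j, k, l} C) :
      General {cpl i j ({k} ∪ C), cpl j k ({l} ∪ C), cpl k l ({i} ∪ C), cpl i l ({j} ∪ C)}
        {cpl i j C}

/-- The thirteen special implications on four variables.  The four indices are `1, 2, 3, 4`, which
are the four different elements of `Fin 4` (there the numeral `4` denotes the element `0`). -/
inductive Special : Relation 4 → Relation 4 → Prop
  | s1 : Special {cpl 2 3 {4}, cpl 2 3 {1, 4}, cpl 2 4 {1}, cpl 3 4 {1}}
      {cpl 2 3 ∅, cpl 2 3 {1}, cpl 2 4 {1, 3}, cpl 3 4 {1, 2}}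
  | s2 : Special {cpl 2 3 ∅, cpl 2 3 {1}, cpl 2 4 {1}, cpl 3 4 {1}}
      {cpl 2 3 {4}, cpl 2 3 {1, 4}, cpl 2 4 {1, 3}, cpl 3 4 {1, 2}}
  | s3 : Special {cpl 1 4 {2}, cpl 1 4 {3}, cpl 1 4 {2, 3}, cpl 2 3 {1, 4}} {cpl 1 4 ∅}
  | s4 : Special {cpl 1 4 ∅, cpl 1 4 {2}, cpl 1 4 {2, 3}, cpl 2 3 {1, 4}} {cpl 1 4 {3}}
  | s5 : Special {cpl 1 4 ∅, cpl 1 4 {2}, cpl 1 4 {3}, cpl 2 3 {1, 4}} {cpl 1 4 {2, 3}}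
  | s6 : Special {cpl 1 4 ∅, cpl 1 4 {2, 3}, cpl 2 3 {1}, cpl 2 3 {1, 4}}
      {cpl 1 4 {2}, cpl 1 4 {3}}
  | s7 : Special {cpl 1 4 {2}, cpl 1 4 {3}, cpl 2 3 {1}, cpl 2 3 {1, 4}}
      {cpl 1 4 ∅, cpl 1 4 {2, 3}}
  | s8 : Special {cpl 1 2 ∅, cpl 1 4 {3}, cpl 1 4 {2, 3}, cpl 2 3 {1, 4}}
      {cpl 1 2 {3}, cpl 1 2 {4}, cpl 1 2 {3, 4}, cpl 2 3 {4}}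
  | s9 : Special {cpl 1 2 ∅, cpl 1 4 {3}, cpl 2 3 {4}, cpl 2 3 {1, 4}}
      {cpl 1 2 {3}, cpl 1 2 {4}, cpl 1 2 {3, 4}, cpl 1 4 {2, 3}}
  | s10 : Special {cpl 1 2 {3}, cpl 1 4 {2}, cpl 2 3 {4}, cpl 2 3 {1, 4}}
      {cpl 1 2 ∅, cpl 1 2 {4}, cpl 1 2 {3, 4}, cpl 1 4 ∅}
  | s11 : Special {cpl 1 2 {3}, cpl 1 4 ∅, cpl 1 4 {2}, cpl 2 3 {1, 4}}
      {cpl 1 2 ∅, cpl 1 2 {4}, cpl 1 2 {3, 4}, cpl 2 3 {4}}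
  | s12 : Special {cpl 1 4 {2}, cpl 2 3 {1}, cpl 2 3 {4}, cpl 2 3 {1, 4}} {cpl 2 3 ∅}
  | s13 : Special {cpl 1 4 {2}, cpl 2 3 ∅, cpl 2 3 {1}, cpl 2 3 {1, 4}} {cpl 2 3 {4}}

/-- The listed implications on four variables: the general ones, the thirteen special ones up to
permutation of the indices, and the duals of the latter. -/
inductive Listed : Relation 4 → Relation 4 → Prop
  | general {K K' : Relation 4} (h : General K K') : Listed K K'
  | special (σ : Equiv.Perm (Fin 4)) {K K' : Relation 4} (h : Special K K') :
      Listed (K.permute σ) (K'.permute σ)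
  | dualSpecial (σ : Equiv.Perm (Fin 4)) {K K' : Relation 4} (h : Special K K') :
      Listed (K.permute σ).dual (K'.permute σ).dual

/-- `Derivable A L c`: the couple `c` is obtained from the couples in `L` by finitely many
applications of implications `K ⇒ K'` belonging to the family `A`. -/
inductive Derivable {m : ℕ} (A : Relation m → Relation m → Prop) (L : Relation m) :
    Couple m → Prop
  | hyp {c : Couple m} (h : c ∈ L) : Derivable A L c
  | step {K K' : Relation m} (hA : A K K') (hK : ∀ c ∈ K, Derivable A L c)
      {c : Couple m} (hc : c ∈ K') : Derivable A L c

/-- The implication `L₁ ⇒ L₂` can be deduced from the family `A` of implications. -/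
def Deducible {m : ℕ} (A : Relation m → Relation m → Prop) (L₁ L₂ : Relation m) : Prop :=
  ∀ c ∈ L₂, Derivable A L₁ c

end GaussianCI

/-! Validity. A positive definite matrix can be rescaled to unit diagonal without changing which
almost-principal minors vanish, so a couple becomes a polynomial equation in six correlations. Each
rule then follows by eliminating down to an equation x·u = 0, or a sum of nonnegative terms, where
positivity of the principal 2×2 and 3×3 minors excludes u = 0. Permuting the indices permutes
couples, and inverting the matrix exchanges a couple with its dual, so `IsImplication` is stable
under both operations; this disposes of the orbits and the duals of the thirteen special rules.

Completeness. Let M be the set of couples derivable from L₁. It is closed under the listed rules, so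
it suffices to show (`exists_mem_Vpd_not_holds`) that for a closed M and a couple c outside it some
positive definite matrix satisfies M but not c. Sixteen explicit integer Gram matrices, with their
permutations and inverses, provide enough models: every closed set avoiding c lies inside the
structure of one of them that also avoids c. By symmetry only three couples c matter, and for each
of them the assertion is a finite Boolean problem on 24 variables: no set is closed under the rules,
avoids c, and meets the set of failing couples of every model in which c fails. A backtracking
search with unit propagation settles it. The search is proved sound (`search_sound`) and is run by
the kernel (`checkTargets_eq_true`); the remaining work translates between couples and bits. -/

namespace GaussianCI

open Matrix

/-! ### Almost-principal minors: inversion, scaling, explicit formulas. -/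

section Determinants

/-- If `B` is a left inverse of `A`, then the vanishing of a minor of `A` implies the vanishing of
a complementary minor of `B`. -/
theorem det_submatrix_eq_zero_of_mul_eq_one {n p q : Type*} [Fintype n] [DecidableEq n]
    [Fintype p] [DecidableEq p] [Fintype q] [DecidableEq q] {A B : Matrix n n ℝ} (hBA : B * A = 1)
    {r c : p → n} {r' c' : q → n} (hc : Function.Injective c) (hc' : Function.Injective c')
    (hr : ∀ x, x ∉ Set.range c' → x ∈ Set.range r) (hr' : ∀ y, r' y ∉ Set.range c)
    (h : (A.submatrix r c).det = 0) : (B.submatrix r' c').det = 0 := by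
  -- A kernel vector argument replaces Jacobi's identity and its signs: extend a kernel vector of
  -- the minor of `A` by zero to `V`. Then `A *ᵥ V` is supported on the range of `c'`, and its
  -- restriction there is a nonzero kernel vector of the minor of `B`, because `B` sends it back to
  -- `V`.
  obtain ⟨v, hv, hAv⟩ := exists_mulVec_eq_zero_iff.mpr h
  set V : n → ℝ := Function.extend c v 0 with hV
  have hVc : ∀ b, V (c b) = v b := fun b => hc.extend_apply v 0 b
  have hV0 : ∀ x, x ∉ Set.range c → V x = 0 := fun x hx => by
    rw [hV, Function.extend_apply' _ _ _ (by simpa using hx)]; rfl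
  have hW0 : ∀ x, x ∉ Set.range c' → (A *ᵥ V) x = 0 := by
    intro x hx
    obtain ⟨a, rfl⟩ := hr x hx
    have := congrFun hAv a
    simp only [mulVec, dotProduct, submatrix_apply, Pi.zero_apply] at this ⊢
    rw [← this]
    refine (Fintype.sum_of_injective c hc _ _ (fun y hy => ?_) fun b => ?_).symm
    · rw [hV0 y hy, mul_zero]
    · rw [hVc]
  have hBW : B *ᵥ (A *ᵥ V) = V := by rw [mulVec_mulVec, hBA, one_mulVec]
  refine exists_mulVec_eq_zero_iff.mp ⟨fun b => (A *ᵥ V) (c' b), fun h0 => hv ?_, ?_⟩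
  · have hW : A *ᵥ V = 0 := by
      ext x
      by_cases hx : x ∈ Set.range c'
      · obtain ⟨b, rfl⟩ := hx
        exact congrFun h0 b
      · exact hW0 x hx
    ext b
    rw [← hVc, ← hBW, hW, mulVec_zero]
    rfl
  · ext a
    have := congrFun hBW (r' a)
    rw [hV0 _ (hr' a)] at this
    simp only [mulVec, dotProduct, submatrix_apply, Pi.zero_apply] at this ⊢
    rw [← this]
    refine Fintype.sum_of_injective c' hc' _ _ (fun y hy => ?_) fun b => rfl
    have := hW0 y hy
    simp only [mulVec, dotProduct] at this
    rw [this, mul_zero]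

variable {m : ℕ} {S : Matrix (Fin m) (Fin m) ℝ}

/-- The index map `Option C → Fin m` with range `iC`. -/
def apIndex (i : Fin m) (C : Finset (Fin m)) (a : Option C) : Fin m :=
  a.elim i fun c => (c : Fin m)

theorem apDet_eq (S : Matrix (Fin m) (Fin m) ℝ) (i j : Fin m) (C : Finset (Fin m)) :
    apDet S i j C = (S.submatrix (apIndex i C) (apIndex j C)).det := rfl

theorem mem_range_apIndex {i : Fin m} {C : Finset (Fin m)} {x : Fin m} :
    x ∈ Set.range (apIndex i C) ↔ x = i ∨ x ∈ C := by
  constructor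
  · rintro ⟨_ | c, rfl⟩
    · exact Or.inl rfl
    · exact Or.inr c.2
  · rintro (rfl | h)
    · exact ⟨none, rfl⟩
    · exact ⟨some ⟨x, h⟩, rfl⟩

theorem apIndex_injective {i : Fin m} {C : Finset (Fin m)} (h : i ∉ C) :
    Function.Injective (apIndex i C) := by
  rintro (_ | a) (_ | b) hab
  · rfl
  · exact absurd (show i ∈ C from (show i = b from hab) ▸ b.2) h
  · exact absurd (show i ∈ C from (show (a : Fin m) = i from hab) ▸ a.2) h
  · exact congrArg some (Subtype.ext hab)

theorem apDet_swap (hS : Sᵀ = S) (i j : Fin m) (C : Finset (Fin m)) :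
    apDet S j i C = apDet S i j C := by
  rw [apDet_eq, ← det_transpose, transpose_submatrix, hS, apDet_eq]

theorem apDet_submatrix (S : Matrix (Fin m) (Fin m) ℝ) (σ : Equiv.Perm (Fin m)) (i j : Fin m)
    (C : Finset (Fin m)) :
    apDet (S.submatrix σ σ) i j C = apDet S (σ i) (σ j) (C.image σ) := by
  let e : C ≃ (C.image σ : Finset (Fin m)) :=
    Equiv.ofBijective (fun c => ⟨σ c, Finset.mem_image_of_mem _ c.2⟩)
      ⟨fun a b h => Subtype.ext (σ.injective (congrArg Subtype.val h)), fun ⟨y, hy⟩ => by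
        obtain ⟨c, hc, rfl⟩ := Finset.mem_image.mp hy
        exact ⟨⟨c, hc⟩, rfl⟩⟩
  rw [apDet_eq, apDet_eq, ← det_submatrix_equiv_self e.optionCongr, submatrix_submatrix,
    submatrix_submatrix]
  congr 2 <;> ext (_ | a) <;> rfl

theorem apDet_inv_eq_zero (hS : S.PosDef) {i j : Fin m} {C : Finset (Fin m)} (hij : i ≠ j)
    (hi : i ∉ C) (hj : j ∉ C) (h : apDet S i j C = 0) :
    apDet S⁻¹ i j ({i, j} ∪ C)ᶜ = 0 := by
  refine det_submatrix_eq_zero_of_mul_eq_one (A := S)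
    (nonsing_inv_mul _ ((isUnit_iff_isUnit_det _).mp hS.isUnit))
    (apIndex_injective hj) (apIndex_injective (i := j) (by simp)) (r := apIndex i C)
    (fun x hx => ?_) (fun y hy => ?_) h
  · have hx' : ¬ (x = j ∨ x ∈ ({i, j} ∪ C)ᶜ) := fun h => hx (mem_range_apIndex.mpr h)
    rw [mem_range_apIndex]
    simp only [Finset.mem_compl, Finset.mem_union, Finset.mem_insert, Finset.mem_singleton] at hx'
    tauto
  · have h1 := mem_range_apIndex.mp (Set.mem_range_self (f := apIndex i ({i, j} ∪ C)ᶜ) y)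
    have h2 := mem_range_apIndex.mp hy
    change apIndex i _ y = i ∨ _ at h1
    change apIndex i _ y = j ∨ apIndex i _ y ∈ C at h2
    simp only [Finset.mem_compl, Finset.mem_union, Finset.mem_insert, Finset.mem_singleton] at h1
    rcases h1 with h1 | h1
    · rw [h1] at h2
      exact h2.elim hij hi
    · tauto

theorem apDet_diagonal_mul_mul (d : Fin m → ℝ) (i j : Fin m) (C : Finset (Fin m)) :
    apDet (diagonal d * S * diagonal d) i j C =
      (∏ a, d (apIndex i C a)) * apDet S i j C * ∏ a, d (apIndex j C a) := by
  have : (diagonal d * S * diagonal d).submatrix (apIndex i C) (apIndex j C) =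
      diagonal (d ∘ apIndex i C) * S.submatrix (apIndex i C) (apIndex j C) *
        diagonal (d ∘ apIndex j C) := by
    ext a b
    simp [mul_diagonal, diagonal_mul]
  rw [apDet_eq, this, det_mul, det_mul, det_diagonal, det_diagonal]
  rfl

/-- A positive definite matrix can be scaled to have unit diagonal, without any effect on the
conditional independences. -/
theorem exists_unit_diagonal (hS : S.PosDef) : ∃ T : Matrix (Fin m) (Fin m) ℝ, T.PosDef ∧
    (∀ i, T i i = 1) ∧ ∀ i j C, apDet T i j C = 0 ↔ apDet S i j C = 0 := by
  have hd : ∀ i, 0 < (√(S i i))⁻¹ := fun i => inv_pos.mpr (Real.sqrt_pos.mpr hS.diag_pos)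
  refine ⟨diagonal (fun i => (√(S i i))⁻¹) * S * diagonal fun i => (√(S i i))⁻¹, ?_, fun i => ?_,
    fun i j C => ?_⟩
  · have := hS.conjTranspose_mul_mul_same (B := diagonal fun i => (√(S i i))⁻¹)
      (mulVec_injective_of_isUnit ((isUnit_iff_isUnit_det _).mpr
        (by rw [det_diagonal]; exact (Finset.prod_pos fun i _ => hd i).ne'.isUnit)))
    rwa [diagonal_conjTranspose] at this
  · rw [mul_diagonal, diagonal_mul]
    have h0 : √(S i i) ≠ 0 := (Real.sqrt_pos.mpr hS.diag_pos).ne'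
    have := Real.mul_self_sqrt (hS.diag_pos (i := i)).le
    field_simp
    nlinarith
  · rw [apDet_diagonal_mul_mul]
    have h1 : ∀ k, ∏ a, (√(S (apIndex k C a) (apIndex k C a)))⁻¹ ≠ 0 :=
      fun k => (Finset.prod_pos fun a _ => hd (apIndex k C a)).ne'
    rw [mul_eq_zero, mul_eq_zero]
    simp only [h1, or_false, false_or]

/-- The almost-principal determinant in terms of an enumeration of the conditioning set. -/
theorem apDet_eq_det {n : ℕ} (S : Matrix (Fin m) (Fin m) ℝ) (i j : Fin m) {C : Finset (Fin m)}
    (g : Fin n → Fin m) (hg : Function.Injective g) (hC : C = Finset.univ.image g) :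
    apDet S i j C =
      (S.submatrix (Fin.cons i g : Fin (n + 1) → Fin m)
        (Fin.cons j g : Fin (n + 1) → Fin m)).det := by
  subst hC
  let e : Fin n ≃ (Finset.univ.image g : Finset (Fin m)) :=
    Equiv.ofBijective (fun c => ⟨g c, Finset.mem_image_of_mem _ (Finset.mem_univ c)⟩)
      ⟨fun a b h => hg (congrArg Subtype.val h), fun ⟨y, hy⟩ => by
        obtain ⟨c, -, rfl⟩ := Finset.mem_image.mp hy
        exact ⟨c, rfl⟩⟩
  rw [apDet_eq, ← det_submatrix_equiv_self ((finSuccEquiv n).trans e.optionCongr),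
    submatrix_submatrix]
  congr 2 <;> (ext a; refine Fin.cases rfl (fun b => rfl) a)

theorem apDet_empty (S : Matrix (Fin m) (Fin m) ℝ) (i j : Fin m) : apDet S i j ∅ = S i j := by
  rw [apDet_eq_det S i j (C := ∅) (n := 0) Fin.elim0 (fun a => a.elim0) rfl]
  simp

theorem apDet_singleton (S : Matrix (Fin m) (Fin m) ℝ) (i j k : Fin m) :
    apDet S i j {k} = S i j * S k k - S i k * S k j := by
  rw [apDet_eq_det S i j (n := 1) ![k] (Function.injective_of_subsingleton _) (by simp),
    det_fin_two]
  simp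

theorem apDet_pair (S : Matrix (Fin m) (Fin m) ℝ) (i j : Fin m) {k l : Fin m} (hkl : k ≠ l) :
    apDet S i j {k, l} = S i j * S k k * S l l - S i j * S k l * S l k - S i k * S k j * S l l +
      S i k * S k l * S l j + S i l * S k j * S l k - S i l * S k k * S l j := by
  rw [apDet_eq_det S i j (n := 2) ![k, l] (by
      intro a b; fin_cases a <;> fin_cases b <;> simp [hkl, hkl.symm])
    (by ext x; simp [eq_comm]), det_fin_three]
  simp

end Determinants

end GaussianCI

namespace GaussianCI

open Matrix

/-! ### Couples as equations between correlations. -/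

section Soundness

variable {m : ℕ} {S : Matrix (Fin m) (Fin m) ℝ}

/-- The matrix `S` satisfies the conditional independence `c`. -/
def Holds (S : Matrix (Fin m) (Fin m) ℝ) (c : Couple m) : Prop :=
  ∀ i j C, cpl i j C = c → apDet S i j C = 0

theorem mem_Vpd {L : Relation m} : S ∈ Vpd L ↔ S.PosDef ∧ ∀ c ∈ L, Holds S c :=
  and_congr_right fun _ => ⟨fun h _ hc i j C e => h i j C (e ▸ hc),
    fun h i j C hc => h _ hc i j C rfl⟩

theorem transpose_eq (hS : S.PosDef) : Sᵀ = S := by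
  rw [← conjTranspose_eq_transpose_of_trivial]
  exact hS.isHermitian

/-- A couple stores the unordered set ij, so it determines i and j only up to exchange; `apDet_swap`
makes this harmless for symmetric matrices. -/
theorem cpl_eq_cpl {i j k l : Fin m} {C D : Finset (Fin m)} (h : cpl i j C = cpl k l D) :
    C = D ∧ (i = k ∧ j = l ∨ i = l ∧ j = k) := by
  obtain ⟨h1, h2⟩ := Prod.mk.inj h
  refine ⟨h2, ?_⟩
  have := Finset.ext_iff.mp h1
  have hi := this i
  have hj := this j
  have hk := this k
  have hl := this l
  simp only [Finset.mem_insert, Finset.mem_singleton] at hi hj hk hl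
  grind

theorem holds_cpl (hS : S.PosDef) {i j : Fin m} {C : Finset (Fin m)} :
    Holds S (cpl i j C) ↔ apDet S i j C = 0 := by
  refine ⟨fun h => h i j C rfl, fun h k l D e => ?_⟩
  obtain ⟨rfl, ⟨rfl, rfl⟩ | ⟨rfl, rfl⟩⟩ := cpl_eq_cpl e
  · exact h
  · rw [apDet_swap (transpose_eq hS), h]

/-- Every positive definite matrix with unit diagonal that satisfies `K` satisfies `K'`. -/
def Sound (K K' : Relation m) : Prop :=
  ∀ S : Matrix (Fin m) (Fin m) ℝ, S.PosDef → (∀ i, S i i = 1) → (∀ c ∈ K, Holds S c) →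
    ∀ c ∈ K', Holds S c

/-- Rescaling to unit diagonal preserves every vanishing minor, so a check on correlation matrices
is enough. -/
theorem Sound.isImplication {K K' : Relation m} (h : Sound K K') (hK : K ⊆ couples m)
    (hK' : K' ⊆ couples m) (hd : Disjoint K K') : IsImplication K K' := by
  refine ⟨hK, hK', hd, Set.ext fun S => ?_⟩
  rw [mem_Vpd, mem_Vpd]
  refine and_congr_right fun hS => ⟨fun hSK c hc => ?_, fun hS c hc =>
    hS c (Finset.mem_union_left _ hc)⟩
  rcases Finset.mem_union.mp hc with hc | hc
  · exact hSK c hc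
  · obtain ⟨T, hT, hT1, hTS⟩ := exists_unit_diagonal hS
    exact fun i j C e => (hTS i j C).mp
      (h T hT hT1 (fun c hc i j C e => (hTS i j C).mpr (hSK c hc i j C e)) c hc i j C e)

theorem holds_empty (hS : S.PosDef) {i j : Fin m} : Holds S (cpl i j ∅) ↔ S i j = 0 := by
  rw [holds_cpl hS, apDet_empty]

theorem holds_singleton (hS : S.PosDef) (h1 : ∀ i, S i i = 1) {i j k : Fin m} :
    Holds S (cpl i j {k}) ↔ S i j = S i k * S k j := by
  rw [holds_cpl hS, apDet_singleton, h1, mul_one, sub_eq_zero]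

theorem holds_pair (hS : S.PosDef) (h1 : ∀ i, S i i = 1) {i j k l : Fin m} (hkl : k ≠ l) :
    Holds S (cpl i j {k, l}) ↔ S i j * (1 - S k l ^ 2) =
      S i k * (S k j - S k l * S l j) + S i l * (S l j - S k l * S k j) := by
  have : S l k = S k l := congrFun (congrFun (transpose_eq hS) k) l
  rw [holds_cpl hS, apDet_pair _ _ _ hkl, h1, h1, this, ← sub_eq_zero (b := _ + _)]
  ring_nf

theorem sq_lt_one (hS : S.PosDef) (h1 : ∀ i, S i i = 1) {i j : Fin m} (hij : i ≠ j) :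
    S i j ^ 2 < 1 := by
  have h := (hS.submatrix (e := ![i, j]) (by
    intro a b; fin_cases a <;> fin_cases b <;> simp [hij, hij.symm])).det_pos
  have : S j i = S i j := congrFun (congrFun (transpose_eq hS) i) j
  rw [det_fin_two] at h
  simp [h1, this] at h
  nlinarith

theorem minor_three_pos (hS : S.PosDef) (h1 : ∀ i, S i i = 1) {i j k : Fin m} (hij : i ≠ j)
    (hik : i ≠ k) (hjk : j ≠ k) :
    0 < 1 - S i j ^ 2 - S i k ^ 2 - S j k ^ 2 + 2 * S i j * S i k * S j k := by
  have h := (hS.submatrix (e := ![i, j, k]) (by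
    intro a b
    fin_cases a <;> fin_cases b <;> simp [hij, hij.symm, hik, hik.symm, hjk, hjk.symm])).det_pos
  have hs : ∀ i j, S j i = S i j := fun i j => congrFun (congrFun (transpose_eq hS) i) j
  rw [det_fin_three] at h
  simp [h1, hs i j, hs i k, hs j k] at h
  nlinarith

end Soundness

end GaussianCI

namespace GaussianCI

open Matrix

/-! ### Validity of the individual rules. -/

section SoundRules

variable {m : ℕ} {S : Matrix (Fin m) (Fin m) ℝ} {i j k l : Fin m}

theorem eq_zero_of_mul_one_sub_sq {x y : ℝ} (hy : y ^ 2 < 1) (h : x * (1 - y ^ 2) = 0) : x = 0 :=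
  (mul_eq_zero.mp h).resolve_right (by linarith)

theorem mul_sq_lt_one {x y : ℝ} (hx : x ^ 2 < 1) (hy : y ^ 2 < 1) : (x * y) ^ 2 < 1 := by
  rw [mul_pow]
  nlinarith [sq_nonneg x, sq_nonneg y]

theorem ne_of_nodup (hd : [i, j, k, l].Nodup) :
    i ≠ j ∧ i ≠ k ∧ i ≠ l ∧ j ≠ k ∧ j ≠ l ∧ k ≠ l := by
  simp only [List.nodup_cons, List.mem_cons, List.not_mem_nil, or_false, not_or] at hd
  tauto

/-- The conditional independences on four indices in terms of the six entries
`S i j, S i k, S i l, S j k, S j l, S k l`. -/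
theorem holds_formulas (hS : S.PosDef) (h1 : ∀ i, S i i = 1) (hd : [i, j, k, l].Nodup) :
    (∀ {x y}, Holds S (cpl x y ∅) ↔ S x y = 0) ∧
    (∀ {x y z}, Holds S (cpl x y {z}) ↔ S x y = S x z * S z y) ∧
    (∀ {x y z w}, [z, w] ∈ [[i, j], [i, k], [i, l], [j, k], [j, l], [k, l]] →
      (Holds S (cpl x y {z, w}) ↔ S x y * (1 - S z w ^ 2) =
        S x z * (S z y - S z w * S w y) + S x w * (S w y - S z w * S z y))) ∧
    S j i = S i j ∧ S k i = S i k ∧ S l i = S i l ∧ S k j = S j k ∧ S l j = S j l ∧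
    S l k = S k l := by
  have hs (i j) : S j i = S i j := congrFun (congrFun (transpose_eq hS) i) j
  refine ⟨holds_empty hS, holds_singleton hS h1, fun {x y z w} h => holds_pair hS h1 ?_, hs _ _,
    hs _ _, hs _ _, hs _ _, hs _ _, hs _ _⟩
  have := ne_of_nodup hd
  simp only [List.mem_cons, List.cons.injEq, and_true, List.not_mem_nil, or_false] at h
  rcases h with ⟨rfl, rfl⟩ | ⟨rfl, rfl⟩ | ⟨rfl, rfl⟩ | ⟨rfl, rfl⟩ | ⟨rfl, rfl⟩ |
    ⟨rfl, rfl⟩ <;> tauto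

theorem sq_entries_lt_one (hS : S.PosDef) (h1 : ∀ i, S i i = 1) (hd : [i, j, k, l].Nodup) :
    S i j ^ 2 < 1 ∧ S i k ^ 2 < 1 ∧ S i l ^ 2 < 1 ∧ S j k ^ 2 < 1 ∧ S j l ^ 2 < 1 ∧
      S k l ^ 2 < 1 := by
  obtain ⟨hij, hik, hil, hjk, hjl, hkl⟩ := ne_of_nodup hd
  exact ⟨sq_lt_one hS h1 hij, sq_lt_one hS h1 hik, sq_lt_one hS h1 hil, sq_lt_one hS h1 hjk,
    sq_lt_one hS h1 hjl, sq_lt_one hS h1 hkl⟩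

/-- The pattern for all rules below: the entries ij, ik, il, jk, jl, kl are named a, b, c, d, e, f,
and only polynomial equations and strict inequalities from positive definiteness remain. -/
theorem sound_union_empty (hd : [i, j, k, l].Nodup) :
    Sound {cpl i j ∅, cpl i k ∅} {cpl i j {k}, cpl i k {j}} := by
  intro S hS h1
  have hF := holds_formulas hS h1 hd
  obtain ⟨ha, hb, hc, hd', he, hf⟩ := sq_entries_lt_one hS h1 hd
  simp only [Finset.mem_insert, Finset.mem_singleton, forall_eq_or_imp, forall_eq, hF]
  clear hF h1 hS
  generalize S i j = a, S i k = b, S i l = c, S j k = d, S j l = e, S k l = f at *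
  grind

theorem sound_contraction_empty (hd : [i, j, k, l].Nodup) :
    Sound {cpl i j ∅, cpl i k {j}} {cpl i k ∅, cpl i j {k}} := by
  intro S hS h1
  have hF := holds_formulas hS h1 hd
  obtain ⟨ha, hb, hc, hd', he, hf⟩ := sq_entries_lt_one hS h1 hd
  simp only [Finset.mem_insert, Finset.mem_singleton, forall_eq_or_imp, forall_eq, hF]
  clear hF h1 hS
  generalize S i j = a, S i k = b, S i l = c, S j k = d, S j l = e, S k l = f at *
  grind

theorem sound_intersection_empty (hd : [i, j, k, l].Nodup) :
    Sound {cpl i j {k}, cpl i k {j}} {cpl i j ∅, cpl i k ∅} := by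
  intro S hS h1
  have hF := holds_formulas hS h1 hd
  obtain ⟨ha, hb, hc, hd', he, hf⟩ := sq_entries_lt_one hS h1 hd
  simp only [Finset.mem_insert, Finset.mem_singleton, forall_eq_or_imp, forall_eq, hF]
  clear hF h1 hS
  generalize S i j = a, S i k = b, S i l = c, S j k = d, S j l = e, S k l = f at *
  rintro ⟨hx, hy⟩
  have := eq_zero_of_mul_one_sub_sq (x := a) hd' (by grind)
  grind

theorem sound_union_singleton (hd : [i, j, k, l].Nodup) :
    Sound {cpl i j {l}, cpl i k {l}} {cpl i j {k, l}, cpl i k {j, l}} := by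
  intro S hS h1
  have hF := holds_formulas hS h1 hd
  obtain ⟨ha, hb, hc, hd', he, hf⟩ := sq_entries_lt_one hS h1 hd
  simp only [Finset.mem_insert, Finset.mem_singleton, forall_eq_or_imp, forall_eq, List.mem_cons,
    true_or, or_true, hF]
  clear hF h1 hS
  generalize S i j = a, S i k = b, S i l = c, S j k = d, S j l = e, S k l = f at *
  grind

theorem sound_contraction_singleton (hd : [i, j, k, l].Nodup) :
    Sound {cpl i j {l}, cpl i k {j, l}} {cpl i k {l}, cpl i j {k, l}} := by
  intro S hS h1
  have hF := holds_formulas hS h1 hd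
  obtain ⟨ha, hb, hc, hd', he, hf⟩ := sq_entries_lt_one hS h1 hd
  simp only [Finset.mem_insert, Finset.mem_singleton, forall_eq_or_imp, forall_eq, List.mem_cons,
    true_or, or_true, hF]
  clear hF h1 hS
  generalize S i j = a, S i k = b, S i l = c, S j k = d, S j l = e, S k l = f at *
  rintro ⟨hx, hy⟩
  have := eq_zero_of_mul_one_sub_sq (x := b - c * f) he (by grind)
  grind

theorem sound_intersection_singleton (hd : [i, j, k, l].Nodup) :
    Sound {cpl i j {k, l}, cpl i k {j, l}} {cpl i j {l}, cpl i k {l}} := by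
  intro S hS h1
  have hF := holds_formulas hS h1 hd
  obtain ⟨ha, hb, hc, hd', he, hf⟩ := sq_entries_lt_one hS h1 hd
  obtain ⟨hij, hik, hil, hjk, hjl, hkl⟩ := ne_of_nodup hd
  have hm := minor_three_pos hS h1 hjk hjl hkl
  simp only [Finset.mem_insert, Finset.mem_singleton, forall_eq_or_imp, forall_eq, List.mem_cons,
    true_or, or_true, hF]
  clear hF h1 hS
  generalize S i j = a, S i k = b, S i l = c, S j k = d, S j l = e, S k l = f at *
  rintro ⟨hx, hy⟩
  -- With a' = a - ce, b' = b - cf, d' = d - ef the hypotheses read a'(1 - f²) = b'd' and b'(1 - e²)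
  -- = a'd'. Eliminating b' leaves the factor (1 - e²)(1 - f²) - d'², which is the principal minor
  -- on j, k, l.
  have hA : (a - c * e) * (1 - d ^ 2 - e ^ 2 - f ^ 2 + 2 * d * e * f) = 0 := by grind
  have := (mul_eq_zero.mp hA).resolve_right hm.ne'
  have := eq_zero_of_mul_one_sub_sq (x := b - c * f) he (by grind)
  grind

theorem sound_more1 (hd : [i, j, k, l].Nodup) :
    Sound {cpl i j ∅, cpl k l ∅, cpl i k {j, l}, cpl j l {i, k}}
      {cpl i k ∅} := by
  intro S hS h1
  have hF := holds_formulas hS h1 hd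
  obtain ⟨ha, hb, hc, hd', he, hf⟩ := sq_entries_lt_one hS h1 hd
  obtain ⟨hij, hik, hil, hjk, hjl, hkl⟩ := ne_of_nodup hd
  have mikl := minor_three_pos hS h1 hik hil hkl
  have mjkl := minor_three_pos hS h1 hjk hjl hkl
  simp only [Finset.mem_insert, Finset.mem_singleton, forall_eq_or_imp, forall_eq, List.mem_cons,
    true_or, or_true, hF]
  clear hF h1 hS
  generalize S i j = a, S i k = b, S i l = c, S j k = d, S j l = e, S k l = f at *
  rintro ⟨rfl, rfl, h3, h4⟩
  by_contra hb0
  -- Here b(1 - e²) = -ced and e(1 - b²) = -bcd. If b ≠ 0, these give (1 - b²)² = c²d², whereas the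
  -- minors on ikl and jkl give c² < 1 - b² and d² < 1 - b².
  have hbe : b ^ 2 = e ^ 2 := by linear_combination b * h3 - e * h4
  have h5 : b * (1 - b ^ 2) = -(c * e * d) := by linear_combination h3 - b * hbe
  have h6 : b ^ 2 * ((1 - b ^ 2) ^ 2 - (c * d) ^ 2) = 0 := by
    linear_combination (b * (1 - b ^ 2) - c * e * d) * h5 - c ^ 2 * d ^ 2 * hbe
  have h7 := (mul_eq_zero.mp h6).resolve_left (pow_ne_zero 2 hb0)
  have h8 : 0 < (1 - b ^ 2) * (1 - b ^ 2 - c ^ 2) := mul_pos (by linarith) (by linarith)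
  have h9 : 0 ≤ c ^ 2 * (1 - b ^ 2 - d ^ 2) := mul_nonneg (sq_nonneg c) (by linarith)
  linarith

theorem sound_more2 (hd : [i, j, k, l].Nodup) :
    Sound {cpl i j ∅, cpl k l {i}, cpl k l {j}, cpl i j {k, l}}
      {cpl k l ∅} := by
  intro S hS h1
  have hF := holds_formulas hS h1 hd
  obtain ⟨ha, hb, hc, hd', he, hf⟩ := sq_entries_lt_one hS h1 hd
  obtain ⟨hij, hik, hil, hjk, hjl, hkl⟩ := ne_of_nodup hd
  have mijk := minor_three_pos hS h1 hij hik hjk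
  simp only [Finset.mem_insert, Finset.mem_singleton, forall_eq_or_imp, forall_eq, List.mem_cons,
    true_or, or_true, hF]
  clear hF h1 hS
  generalize S i j = a, S i k = b, S i l = c, S j k = d, S j l = e, S k l = f at *
  rintro ⟨rfl, h2, h3, h4⟩
  -- Multiply the equation of ij|kl by ce and use f = bc = de. The factor 1 - b² - d² is the minor
  -- on ijk, so both sides must vanish.
  have h5 : f ^ 2 = -((1 - b ^ 2 - d ^ 2) * (c * e) ^ 2) := by grind
  have h6 : 0 ≤ (1 - b ^ 2 - d ^ 2) * (c * e) ^ 2 := mul_nonneg (by linarith) (sq_nonneg _)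
  exact pow_eq_zero_iff two_ne_zero |>.mp (le_antisymm (by linarith) (sq_nonneg f))

theorem sound_more3 (hd : [i, j, k, l].Nodup) :
    Sound {cpl i j ∅, cpl j l {k}, cpl k l {i}, cpl i k {j, l}}
      {cpl i k ∅} := by
  intro S hS h1
  have hF := holds_formulas hS h1 hd
  obtain ⟨ha, hb, hc, hd', he, hf⟩ := sq_entries_lt_one hS h1 hd
  simp only [Finset.mem_insert, Finset.mem_singleton, forall_eq_or_imp, forall_eq, List.mem_cons,
    true_or, or_true, hF]
  clear hF h1 hS
  generalize S i j = a, S i k = b, S i l = c, S j k = d, S j l = e, S k l = f at *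
  rintro ⟨rfl, rfl, rfl, h4⟩
  have h5 : b * ((1 - c ^ 2) + (c * d) ^ 2 * (1 - b ^ 2)) = 0 := by linear_combination h4
  have h6 : 0 ≤ (c * d) ^ 2 * (1 - b ^ 2) := mul_nonneg (sq_nonneg _) (by linarith)
  exact (mul_eq_zero.mp h5).resolve_right (by linarith)

theorem sound_more4 (hd : [i, j, k, l].Nodup) :
    Sound {cpl i j {k}, cpl i k {l}, cpl i l {j}}
      {cpl i j ∅} := by
  intro S hS h1
  have hF := holds_formulas hS h1 hd
  obtain ⟨ha, hb, hc, hd', he, hf⟩ := sq_entries_lt_one hS h1 hd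
  simp only [Finset.mem_insert, Finset.mem_singleton, forall_eq_or_imp, forall_eq, hF]
  clear hF h1 hS
  generalize S i j = a, S i k = b, S i l = c, S j k = d, S j l = e, S k l = f at *
  rintro ⟨h2, h3, h4⟩
  -- Substituting around the cycle a = bd, b = cf, c = ae returns to a with the factor def, of
  -- absolute value below 1.
  have h5 := mul_sq_lt_one (mul_sq_lt_one hd' he) hf
  exact (mul_eq_zero.mp (show a * (1 - d * e * f) = 0 by grind)).resolve_right (by nlinarith)

theorem sound_more5 (hd : [i, j, k, l].Nodup) :
    Sound {cpl i j {k}, cpl j k {l}, cpl k l {i}, cpl i l {j}}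
      {cpl i j ∅} := by
  intro S hS h1
  have hF := holds_formulas hS h1 hd
  obtain ⟨ha, hb, hc, hd', he, hf⟩ := sq_entries_lt_one hS h1 hd
  simp only [Finset.mem_insert, Finset.mem_singleton, forall_eq_or_imp, forall_eq, hF]
  clear hF h1 hS
  generalize S i j = a, S i k = b, S i l = c, S j k = d, S j l = e, S k l = f at *
  rintro ⟨h2, h3, h4, h5⟩
  -- The cycle a = bd, d = ef, f = bc, c = ae gives a = a(be)².
  exact eq_zero_of_mul_one_sub_sq (mul_sq_lt_one hb he) (by grind)

theorem sound_special1 (hd : [i, j, k, l].Nodup) :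
    Sound {cpl j k {l}, cpl j k {i, l}, cpl j l {i}, cpl k l {i}}
      {cpl j k ∅, cpl j k {i}, cpl j l {i, k}, cpl k l {i, j}} := by
  intro S hS h1
  have hF := holds_formulas hS h1 hd
  obtain ⟨ha, hb, hc, hd', he, hf⟩ := sq_entries_lt_one hS h1 hd
  simp only [Finset.mem_insert, Finset.mem_singleton, forall_eq_or_imp, forall_eq, List.mem_cons,
    true_or, or_true, hF]
  clear hF h1 hS
  generalize S i j = a, S i k = b, S i l = c, S j k = d, S j l = e, S k l = f at *
  rintro ⟨h1, h2, h3, h4⟩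
  -- Substituting d = ef, e = ac, f = bc into jk|il yields ab(1 - c²)² = 0.
  have h5 : a * b * (1 - c ^ 2) = 0 := eq_zero_of_mul_one_sub_sq hc (by grind)
  have h6 := eq_zero_of_mul_one_sub_sq hc h5
  grind

theorem sound_special2 (hd : [i, j, k, l].Nodup) :
    Sound {cpl j k ∅, cpl j k {i}, cpl j l {i}, cpl k l {i}}
      {cpl j k {l}, cpl j k {i, l}, cpl j l {i, k}, cpl k l {i, j}} := by
  intro S hS h1
  have hF := holds_formulas hS h1 hd
  obtain ⟨ha, hb, hc, hd', he, hf⟩ := sq_entries_lt_one hS h1 hd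
  simp only [Finset.mem_insert, Finset.mem_singleton, forall_eq_or_imp, forall_eq, List.mem_cons,
    true_or, or_true, hF]
  clear hF h1 hS
  generalize S i j = a, S i k = b, S i l = c, S j k = d, S j l = e, S k l = f at *
  grind

theorem sound_special3 (hd : [i, j, k, l].Nodup) :
    Sound {cpl i l {j}, cpl i l {k}, cpl i l {j, k}, cpl j k {i, l}}
      {cpl i l ∅} := by
  intro S hS h1
  have hF := holds_formulas hS h1 hd
  obtain ⟨ha, hb, hc, hd', he, hf⟩ := sq_entries_lt_one hS h1 hd
  simp only [Finset.mem_insert, Finset.mem_singleton, forall_eq_or_imp, forall_eq, List.mem_cons,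
    true_or, or_true, hF]
  clear hF h1 hS
  generalize S i j = a, S i k = b, S i l = c, S j k = d, S j l = e, S k l = f at *
  rintro ⟨h1, h2, h3, h4⟩
  -- Since c = ae = bf, the remaining two equations prescribe the sum and the product of each pair:
  -- ab, ef on one side and daf, dbe on the other. So d is one of ab, ef and c is one of daf, dbe;
  -- each combination gives c = x²c for some correlation x.
  have h5 : (a * b - d) * (e * f - d) = 0 := by grind
  by_contra hc0
  have h6 : (d * (a * f) - c) * (d * (b * e) - c) = 0 := by grind
  rcases mul_eq_zero.mp h5 with h5 | h5 <;> rcases mul_eq_zero.mp h6 with h6 | h6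
  · exact hc0 (eq_zero_of_mul_one_sub_sq ha (by grind))
  · exact hc0 (eq_zero_of_mul_one_sub_sq hb (by grind))
  · exact hc0 (eq_zero_of_mul_one_sub_sq hf (by grind))
  · exact hc0 (eq_zero_of_mul_one_sub_sq he (by grind))

theorem sound_special4 (hd : [i, j, k, l].Nodup) :
    Sound {cpl i l ∅, cpl i l {j}, cpl i l {j, k}, cpl j k {i, l}}
      {cpl i l {k}} := by
  intro S hS h1
  have hF := holds_formulas hS h1 hd
  obtain ⟨ha, hb, hc, hd', he, hf⟩ := sq_entries_lt_one hS h1 hd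
  simp only [Finset.mem_insert, Finset.mem_singleton, forall_eq_or_imp, forall_eq, List.mem_cons,
    true_or, or_true, hF]
  clear hF h1 hS
  generalize S i j = a, S i k = b, S i l = c, S j k = d, S j l = e, S k l = f at *
  rintro ⟨h1, h2, h3, h4⟩
  have h5 : a * e = 0 := by grind
  rcases mul_eq_zero.mp h5 with h5 | h5
  · have := eq_zero_of_mul_one_sub_sq (x := b * f) he (by grind)
    grind
  · have := eq_zero_of_mul_one_sub_sq (x := b * f) ha (by grind)
    grind

theorem sound_special5 (hd : [i, j, k, l].Nodup) :
    Sound {cpl i l ∅, cpl i l {j}, cpl i l {k}, cpl j k {i, l}}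
      {cpl i l {j, k}} := by
  intro S hS h1
  have hF := holds_formulas hS h1 hd
  obtain ⟨ha, hb, hc, hd', he, hf⟩ := sq_entries_lt_one hS h1 hd
  simp only [Finset.mem_insert, Finset.mem_singleton, forall_eq_or_imp, forall_eq, List.mem_cons,
    true_or, or_true, hF]
  clear hF h1 hS
  generalize S i j = a, S i k = b, S i l = c, S j k = d, S j l = e, S k l = f at *
  grind

theorem sound_special6 (hd : [i, j, k, l].Nodup) :
    Sound {cpl i l ∅, cpl i l {j, k}, cpl j k {i}, cpl j k {i, l}}
      {cpl i l {j}, cpl i l {k}} := by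
  intro S hS h1
  have hF := holds_formulas hS h1 hd
  obtain ⟨ha, hb, hc, hd', he, hf⟩ := sq_entries_lt_one hS h1 hd
  simp only [Finset.mem_insert, Finset.mem_singleton, forall_eq_or_imp, forall_eq, List.mem_cons,
    true_or, or_true, hF]
  clear hF h1 hS
  generalize S i j = a, S i k = b, S i l = c, S j k = d, S j l = e, S k l = f at *
  rintro ⟨h1, h2, h3, h4⟩
  have h5 : e * f = 0 := by grind
  rcases mul_eq_zero.mp h5 with h5 | h5
  · have := eq_zero_of_mul_one_sub_sq (x := b * f) ha (by grind)
    grind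
  · have := eq_zero_of_mul_one_sub_sq (x := a * e) hb (by grind)
    grind

theorem sound_special7 (hd : [i, j, k, l].Nodup) :
    Sound {cpl i l {j}, cpl i l {k}, cpl j k {i}, cpl j k {i, l}}
      {cpl i l ∅, cpl i l {j, k}} := by
  intro S hS h1
  have hF := holds_formulas hS h1 hd
  obtain ⟨ha, hb, hc, hd', he, hf⟩ := sq_entries_lt_one hS h1 hd
  simp only [Finset.mem_insert, Finset.mem_singleton, forall_eq_or_imp, forall_eq, List.mem_cons,
    true_or, or_true, hF]
  clear hF h1 hS
  generalize S i j = a, S i k = b, S i l = c, S j k = d, S j l = e, S k l = f at *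
  rintro ⟨h1, h2, h3, h4⟩
  -- Eliminating c = ae = bf and d = ab leaves ef(1 - a²)(1 - b²) = 0.
  have h5 : e * f * (1 - a ^ 2) = 0 := eq_zero_of_mul_one_sub_sq hb (by grind)
  have h6 := eq_zero_of_mul_one_sub_sq ha h5
  rcases mul_eq_zero.mp h6 with h6 | h6 <;> grind

theorem sound_special8 (hd : [i, j, k, l].Nodup) :
    Sound {cpl i j ∅, cpl i l {k}, cpl i l {j, k}, cpl j k {i, l}}
      {cpl i j {k}, cpl i j {l}, cpl i j {k, l}, cpl j k {l}} := by
  intro S hS h1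
  have hF := holds_formulas hS h1 hd
  obtain ⟨ha, hb, hc, hd', he, hf⟩ := sq_entries_lt_one hS h1 hd
  simp only [Finset.mem_insert, Finset.mem_singleton, forall_eq_or_imp, forall_eq, List.mem_cons,
    true_or, or_true, hF]
  clear hF h1 hS
  generalize S i j = a, S i k = b, S i l = c, S j k = d, S j l = e, S k l = f at *
  rintro ⟨h1, h2, h3, h4⟩
  have h5 : b * d * (e - d * f) = 0 := by grind
  have h6 : b * d = 0 := by
    rcases mul_eq_zero.mp h5 with h5 | h5
    · exact h5
    · have := eq_zero_of_mul_one_sub_sq (x := d) hf (by grind)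
      grind
  rcases mul_eq_zero.mp h6 with h6 | h6
  · grind
  · have := eq_zero_of_mul_one_sub_sq (x := e * f) hb (by grind)
    grind

theorem sound_special9 (hd : [i, j, k, l].Nodup) :
    Sound {cpl i j ∅, cpl i l {k}, cpl j k {l}, cpl j k {i, l}}
      {cpl i j {k}, cpl i j {l}, cpl i j {k, l}, cpl i l {j, k}} := by
  intro S hS h1
  have hF := holds_formulas hS h1 hd
  obtain ⟨ha, hb, hc, hd', he, hf⟩ := sq_entries_lt_one hS h1 hd
  simp only [Finset.mem_insert, Finset.mem_singleton, forall_eq_or_imp, forall_eq, List.mem_cons,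
    true_or, or_true, hF]
  clear hF h1 hS
  generalize S i j = a, S i k = b, S i l = c, S j k = d, S j l = e, S k l = f at *
  rintro ⟨h1, h2, h3, h4⟩
  have h5 : b * e * f * (b * f * (1 - f ^ 2)) = 0 := by grind
  have h6 : b * e * f = 0 := by
    rcases mul_eq_zero.mp h5 with h5 | h5
    · exact h5
    · have := eq_zero_of_mul_one_sub_sq hf h5
      grind
  grind

theorem sound_special10 (hd : [i, j, k, l].Nodup) :
    Sound {cpl i j {k}, cpl i l {j}, cpl j k {l}, cpl j k {i, l}}
      {cpl i j ∅, cpl i j {l}, cpl i j {k, l}, cpl i l ∅} := by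
  intro S hS h1
  have hF := holds_formulas hS h1 hd
  obtain ⟨ha, hb, hc, hd', he, hf⟩ := sq_entries_lt_one hS h1 hd
  simp only [Finset.mem_insert, Finset.mem_singleton, forall_eq_or_imp, forall_eq, List.mem_cons,
    true_or, or_true, hF]
  clear hF h1 hS
  generalize S i j = a, S i k = b, S i l = c, S j k = d, S j l = e, S k l = f at *
  rintro ⟨h1, h2, h3, h4⟩
  -- Eliminating a, c, d leaves b²ef(1 - e²)(1 - e²f²) = 0.
  have h5 : b * (b * e * f) * (1 - e ^ 2) = 0 :=
    eq_zero_of_mul_one_sub_sq (mul_sq_lt_one he hf) (by grind)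
  have h6 := eq_zero_of_mul_one_sub_sq he h5
  have h7 : b * e * f = 0 := by grind
  grind

theorem sound_special11 (hd : [i, j, k, l].Nodup) :
    Sound {cpl i j {k}, cpl i l ∅, cpl i l {j}, cpl j k {i, l}}
      {cpl i j ∅, cpl i j {l}, cpl i j {k, l}, cpl j k {l}} := by
  intro S hS h1
  have hF := holds_formulas hS h1 hd
  obtain ⟨ha, hb, hc, hd', he, hf⟩ := sq_entries_lt_one hS h1 hd
  simp only [Finset.mem_insert, Finset.mem_singleton, forall_eq_or_imp, forall_eq, List.mem_cons,
    true_or, or_true, hF]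
  clear hF h1 hS
  generalize S i j = a, S i k = b, S i l = c, S j k = d, S j l = e, S k l = f at *
  rintro ⟨h1, h2, h3, h4⟩
  have h5 : a * e = 0 := by grind
  have h6 : a = 0 := by
    rcases mul_eq_zero.mp h5 with h5 | h5
    · exact h5
    · have := eq_zero_of_mul_one_sub_sq (x := d) hb (by grind)
      grind
  grind

theorem sound_special12 (hd : [i, j, k, l].Nodup) :
    Sound {cpl i l {j}, cpl j k {i}, cpl j k {l}, cpl j k {i, l}}
      {cpl j k ∅} := by
  intro S hS h1
  have hF := holds_formulas hS h1 hd
  obtain ⟨ha, hb, hc, hd', he, hf⟩ := sq_entries_lt_one hS h1 hd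
  simp only [Finset.mem_insert, Finset.mem_singleton, forall_eq_or_imp, forall_eq, List.mem_cons,
    true_or, or_true, hF]
  clear hF h1 hS
  generalize S i j = a, S i k = b, S i l = c, S j k = d, S j l = e, S k l = f at *
  rintro ⟨h1, h2, h3, h4⟩
  -- With c = ae and d = ab = ef, the couple jk|il becomes d(1 - a²)(1 - e²) = 0.
  have h5 : d * (1 - a ^ 2) = 0 := eq_zero_of_mul_one_sub_sq he (by grind)
  exact eq_zero_of_mul_one_sub_sq ha h5

theorem sound_special13 (hd : [i, j, k, l].Nodup) :
    Sound {cpl i l {j}, cpl j k ∅, cpl j k {i}, cpl j k {i, l}}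
      {cpl j k {l}} := by
  intro S hS h1
  have hF := holds_formulas hS h1 hd
  obtain ⟨ha, hb, hc, hd', he, hf⟩ := sq_entries_lt_one hS h1 hd
  simp only [Finset.mem_insert, Finset.mem_singleton, forall_eq_or_imp, forall_eq, List.mem_cons,
    true_or, or_true, hF]
  clear hF h1 hS
  generalize S i j = a, S i k = b, S i l = c, S j k = d, S j l = e, S k l = f at *
  rintro ⟨h1, h2, h3, h4⟩
  have h5 := eq_zero_of_mul_one_sub_sq (x := e * f) ha (by grind)
  grind

end SoundRules

end GaussianCI

namespace GaussianCI

open Matrix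

/-! ### Permutation and duality of couples and implications. -/

section Symmetries

variable {m : ℕ} {S : Matrix (Fin m) (Fin m) ℝ}

theorem mem_couples {c : Couple m} : c ∈ couples m ↔ ∃ i j C, i ≠ j ∧ i ∉ C ∧ j ∉ C ∧
    c = cpl i j C := by
  simp only [couples, Finset.mem_filter, Finset.mem_univ, true_and, Finset.card_eq_two]
  constructor
  · rintro ⟨⟨i, j, hij, h⟩, hd⟩
    rw [h] at hd
    simp only [Finset.disjoint_insert_left, Finset.disjoint_singleton_left] at hd
    exact ⟨i, j, c.2, hij, hd.1, hd.2, Prod.ext h rfl⟩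
  · rintro ⟨i, j, C, hij, hi, hj, rfl⟩
    exact ⟨⟨i, j, hij, rfl⟩, by simp [cpl, hi, hj]⟩

/-- The couple obtained by applying a permutation of the indices. -/
def Couple.permute (σ : Equiv.Perm (Fin m)) (c : Couple m) : Couple m :=
  (c.1.image σ, c.2.image σ)

theorem permute_eq_image (σ : Equiv.Perm (Fin m)) (L : Relation m) :
    L.permute σ = L.image (Couple.permute σ) := rfl

theorem permute_cpl (σ : Equiv.Perm (Fin m)) (i j : Fin m) (C : Finset (Fin m)) :
    (cpl i j C).permute σ = cpl (σ i) (σ j) (C.image σ) := by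
  simp [Couple.permute, cpl, Finset.image_insert]

theorem permute_injective (σ : Equiv.Perm (Fin m)) :
    Function.Injective (Couple.permute σ) := fun _ _ h =>
  Prod.ext (Finset.image_injective σ.injective (congrArg Prod.fst h))
    (Finset.image_injective σ.injective (congrArg Prod.snd h))

theorem permute_mem_couples {σ : Equiv.Perm (Fin m)} {c : Couple m} :
    c.permute σ ∈ couples m ↔ c ∈ couples m := by
  simp only [couples, Finset.mem_filter, Finset.mem_univ, true_and, Couple.permute,
    Finset.card_image_of_injective _ σ.injective, Finset.disjoint_image σ.injective]

theorem holds_permute (σ : Equiv.Perm (Fin m)) {c : Couple m} :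
    Holds S (c.permute σ) ↔ Holds (S.submatrix σ σ) c := by
  constructor
  · rintro h i j C rfl
    rw [apDet_submatrix]
    exact h _ _ _ (permute_cpl σ i j C).symm
  · intro h i j C e
    obtain ⟨i, rfl⟩ := σ.surjective i
    obtain ⟨j, rfl⟩ := σ.surjective j
    obtain ⟨D, rfl⟩ : ∃ D : Finset (Fin m), C = D.image σ :=
      ⟨C.image σ.symm, by simp [Finset.image_image]⟩
    rw [← permute_cpl] at e
    rw [← apDet_submatrix]
    exact h i j D (permute_injective σ e)

theorem dual_mem_couples {c : Couple m} (hc : c ∈ couples m) : c.dual ∈ couples m := by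
  obtain ⟨i, j, C, hij, hi, hj, rfl⟩ := mem_couples.mp hc
  exact mem_couples.mpr ⟨i, j, _, hij, by simp [cpl], by simp [cpl], rfl⟩

theorem dual_dual {c : Couple m} (hc : c ∈ couples m) : c.dual.dual = c := by
  have hd : Disjoint c.1 c.2 := (Finset.mem_filter.mp hc).2.2
  refine Prod.ext rfl (Finset.ext fun x => ?_)
  have : x ∈ c.1 → x ∉ c.2 := fun h => Finset.disjoint_left.mp hd h
  simp only [Couple.dual, Finset.mem_compl, Finset.mem_union]
  tauto

theorem Holds.dual (hS : S.PosDef) {c : Couple m} (hc : c ∈ couples m) (h : Holds S c) :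
    Holds S⁻¹ c.dual := by
  obtain ⟨i, j, C, hij, hi, hj, rfl⟩ := mem_couples.mp hc
  exact (holds_cpl hS.inv).mpr (apDet_inv_eq_zero hS hij hi hj (h i j C rfl))

theorem inv_inv_of_posDef (hS : S.PosDef) : S⁻¹⁻¹ = S :=
  nonsing_inv_nonsing_inv _ ((isUnit_iff_isUnit_det _).mp hS.isUnit)

/-- One direction is the complementary minor lemma; the other is the same lemma applied to the
inverse, since dualizing and inverting are both involutions. -/
theorem holds_dual (hS : S.PosDef) {c : Couple m} (hc : c ∈ couples m) :
    Holds S⁻¹ c.dual ↔ Holds S c := by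
  refine ⟨fun h => ?_, Holds.dual hS hc⟩
  have := h.dual hS.inv (dual_mem_couples hc)
  rwa [inv_inv_of_posDef hS, dual_dual hc] at this

theorem IsImplication.permute {K K' : Relation m} (h : IsImplication K K')
    (σ : Equiv.Perm (Fin m)) : IsImplication (K.permute σ) (K'.permute σ) := by
  obtain ⟨hK, hK', hd, hV⟩ := h
  have key : ∀ L : Relation m, Vpd (L.permute σ) = {S | S.submatrix σ σ ∈ Vpd L} := by
    intro L
    ext S
    simp only [mem_Vpd, Set.mem_ofPred_eq, permute_eq_image, Finset.forall_mem_image,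
      holds_permute]
    refine and_congr_left fun _ => ⟨fun h => h.submatrix σ.injective, fun h => ?_⟩
    simpa using h.submatrix σ.symm.injective
  have hu : K.permute σ ∪ K'.permute σ = (K ∪ K').permute σ := (Finset.image_union _ _).symm
  refine ⟨?_, ?_, (Finset.disjoint_image (permute_injective σ)).mpr hd, ?_⟩
  · exact Finset.image_subset_iff.mpr fun c hc => permute_mem_couples.mpr (hK hc)
  · exact Finset.image_subset_iff.mpr fun c hc => permute_mem_couples.mpr (hK' hc)
  · rw [hu, key, key, hV]

theorem IsImplication.dual {K K' : Relation m} (h : IsImplication K K') :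
    IsImplication K.dual K'.dual := by
  obtain ⟨hK, hK', hd, hV⟩ := h
  have key : ∀ L : Relation m, L ⊆ couples m → Vpd L.dual = {S | S⁻¹ ∈ Vpd L} := by
    intro L hL
    ext S
    simp only [mem_Vpd, Set.mem_ofPred_eq, Relation.dual, Finset.forall_mem_image]
    constructor
    · rintro ⟨hS, h⟩
      exact ⟨hS.inv, fun c hc => by
        rw [← holds_dual hS.inv (hL hc), inv_inv_of_posDef hS]; exact h hc⟩
    · rintro ⟨hS, h⟩
      -- In this direction only `S⁻¹` is known to be positive definite. Its determinant is a unit,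
      -- which forces `S` to be invertible and hence to be the inverse of `S⁻¹`.
      have hu := (isUnit_iff_isUnit_det _).mp hS.isUnit
      have hi : S⁻¹⁻¹ = S := nonsing_inv_nonsing_inv _ (by simpa using hu)
      refine ⟨hi ▸ hS.inv, fun c hc => ?_⟩
      rw [← hi, holds_dual hS (hL hc)]
      exact h c hc
  have hu : K.dual ∪ K'.dual = (K ∪ K').dual := (Finset.image_union _ _).symm
  refine ⟨?_, ?_, ?_, ?_⟩
  · exact Finset.image_subset_iff.mpr fun c hc => dual_mem_couples (hK hc)
  · exact Finset.image_subset_iff.mpr fun c hc => dual_mem_couples (hK' hc)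
  · rw [Finset.disjoint_left]
    intro c h1 h2
    obtain ⟨c, hc, rfl⟩ := Finset.mem_image.mp h1
    obtain ⟨d, hd', e⟩ := Finset.mem_image.mp h2
    rw [← dual_dual (hK hc), ← e, dual_dual (hK' hd')] at hc
    exact Finset.disjoint_left.mp hd hc hd'
  · rw [hu, key _ hK, key _ (Finset.union_subset hK hK'), hV]

end Symmetries

/-! ### Every listed pair is an implication. -/

section ListedImplications

/-- On four indices the conditioning set of a semigaussoid rule is empty or the single remaining
index, so each such rule has just two cases. -/
theorem exists_fourth_index : ∀ i j k : Fin 4, [i, j, k].Nodup → ∃ l, [i, j, k, l].Nodup ∧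
    ∀ C : Finset (Fin 4), Disjoint {i, j, k} C → C = ∅ ∨ C = {l} := by
  decide +kernel

theorem eq_empty_of_disjoint_four : ∀ (i j k l : Fin 4) (C : Finset (Fin 4)),
    [i, j, k, l].Nodup → Disjoint {i, j, k, l} C → C = ∅ := by
  decide +kernel

theorem nodup_one_two_three_four : [(1 : Fin 4), 2, 3, 4].Nodup := by decide

theorem cpl_mem_couples {m : ℕ} {i j : Fin m} {C : Finset (Fin m)} :
    cpl i j C ∈ couples m ↔ i ≠ j ∧ i ∉ C ∧ j ∉ C := by
  refine ⟨fun h => ?_, fun h => mem_couples.mpr ⟨i, j, C, h.1, h.2.1, h.2.2, rfl⟩⟩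
  have h := (Finset.mem_filter.mp h).2
  have hij : i ≠ j := fun hij => by simp [cpl, hij] at h
  simpa [cpl, hij] using h.2

theorem cpl_eq_cpl_iff {m : ℕ} {i j k l : Fin m} {C D : Finset (Fin m)} :
    cpl i j C = cpl k l D ↔ C = D ∧ (i = k ∧ j = l ∨ i = l ∧ j = k) := by
  refine ⟨cpl_eq_cpl, ?_⟩
  rintro ⟨rfl, ⟨rfl, rfl⟩ | ⟨rfl, rfl⟩⟩
  · rfl
  · simp [cpl, Finset.pair_comm]

theorem General.subset_and_disjoint {m : ℕ} {K K' : Relation m} (h : General K K') :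
    K ⊆ couples m ∧ K' ⊆ couples m ∧ Disjoint K K' := by
  cases h <;> rename_i hd hC <;>
    simp only [List.nodup_cons, List.mem_cons, List.not_mem_nil, or_false, not_or,
      Finset.disjoint_insert_left, Finset.disjoint_singleton_left] at hd hC <;>
    simp only [Finset.insert_subset_iff, Finset.singleton_subset_iff, cpl_mem_couples,
      Finset.disjoint_insert_left, Finset.disjoint_singleton_left, Finset.mem_insert,
      Finset.mem_singleton, cpl_eq_cpl_iff, Finset.mem_union, Finset.union_eq_right,
      Finset.right_eq_union] <;>
    grind

theorem sound_of_general {K K' : Relation 4} (h : General K K') : Sound K K' := by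
  cases h with
  | union i j k C hd hC =>
    obtain ⟨l, hl, hCl⟩ := exists_fourth_index i j k hd
    obtain rfl | rfl := hCl C hC
    · simpa only [Finset.union_empty] using sound_union_empty hl
    · simpa only [Finset.singleton_union] using sound_union_singleton hl
  | contraction i j k C hd hC =>
    obtain ⟨l, hl, hCl⟩ := exists_fourth_index i j k hd
    obtain rfl | rfl := hCl C hC
    · simpa only [Finset.union_empty] using sound_contraction_empty hl
    · simpa only [Finset.singleton_union] using sound_contraction_singleton hl
  | intersection i j k C hd hC =>
    obtain ⟨l, hl, hCl⟩ := exists_fourth_index i j k hd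
    obtain rfl | rfl := hCl C hC
    · simpa only [Finset.union_empty] using sound_intersection_empty hl
    · simpa only [Finset.singleton_union] using sound_intersection_singleton hl
  | more1 i j k l C hd hC =>
    obtain rfl := eq_empty_of_disjoint_four i j k l C hd hC
    simpa only [Finset.union_empty] using sound_more1 hd
  | more2 i j k l C hd hC =>
    obtain rfl := eq_empty_of_disjoint_four i j k l C hd hC
    simpa only [Finset.union_empty] using sound_more2 hd
  | more3 i j k l C hd hC =>
    obtain rfl := eq_empty_of_disjoint_four i j k l C hd hC
    simpa only [Finset.union_empty] using sound_more3 hd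
  | more4 i j k l C hd hC =>
    obtain rfl := eq_empty_of_disjoint_four i j k l C hd hC
    simpa only [Finset.union_empty] using sound_more4 hd
  | more5 i j k l C hd hC =>
    obtain rfl := eq_empty_of_disjoint_four i j k l C hd hC
    simpa only [Finset.union_empty] using sound_more5 hd

theorem isImplication_of_general {K K' : Relation 4} (h : General K K') : IsImplication K K' :=
  (sound_of_general h).isImplication h.subset_and_disjoint.1 h.subset_and_disjoint.2.1
    h.subset_and_disjoint.2.2

theorem sound_of_special {K K' : Relation 4} (h : Special K K') : Sound K K' := by
  have hd := nodup_one_two_three_four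
  cases h with
  | s1 => exact sound_special1 hd
  | s2 => exact sound_special2 hd
  | s3 => exact sound_special3 hd
  | s4 => exact sound_special4 hd
  | s5 => exact sound_special5 hd
  | s6 => exact sound_special6 hd
  | s7 => exact sound_special7 hd
  | s8 => exact sound_special8 hd
  | s9 => exact sound_special9 hd
  | s10 => exact sound_special10 hd
  | s11 => exact sound_special11 hd
  | s12 => exact sound_special12 hd
  | s13 => exact sound_special13 hd

theorem isImplication_of_special {K K' : Relation 4} (h : Special K K') : IsImplication K K' := by
  refine (sound_of_special h).isImplication ?_ ?_ ?_ <;> cases h <;> decide +kernel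

theorem isImplication_of_listed {K K' : Relation 4} (h : Listed K K') : IsImplication K K' := by
  cases h with
  | general h => exact isImplication_of_general h
  | special σ h => exact (isImplication_of_special h).permute σ
  | dualSpecial σ h => exact ((isImplication_of_special h).permute σ).dual

end ListedImplications

end GaussianCI

namespace GaussianCI

/-! ### A verified backtracking search on bit masks. -/

section Search

/-- The value `f n`, computed after `n` has been evaluated to a numeral. -/
def force (n : ℕ) (f : ℕ → Bool) : Bool :=
  -- The case split makes the kernel reduce `n` to a literal before it is substituted; otherwise
  -- unevaluated arithmetic would be copied into `f`.
  Nat.casesOn n (f 0) fun k => f k.succ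

/-- Pass through the implications in the list, where `T` and `F` are bit masks of the elements
known to be present and absent; the implications that are not yet settled are collected. -/
def propagate : List (ℕ × ℕ) → List (ℕ × ℕ) → ℕ → ℕ → (List (ℕ × ℕ) → ℕ → ℕ → Bool) → Bool
  | [], acc, T, F, k => k acc T F
  | r :: rs, acc, T, F, k =>
    -- A rule with an excluded premise can never fire and is dropped. A rule with all premises
    -- present fires. If the conclusion meets `F` and one premise is open, that premise is excluded;
    -- any other rule is kept.
    bif Nat.beq (Nat.land r.1 F) 0 then
      bif Nat.beq (Nat.lor r.1 T) T then force (Nat.lor T r.2) fun T' => propagate rs acc T' F k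
      else bif Nat.beq (Nat.land r.2 F) 0 then propagate rs (r :: acc) T F k
      -- `d` is the set of premises not yet in `T`, and `d & (d - 1) = 0` tests that it has at most
      -- one element.
      else force (Nat.xor (Nat.lor r.1 T) T) fun d =>
        bif Nat.beq (Nat.land d (Nat.sub d 1)) 0 then
          force (Nat.lor F d) fun F' => propagate rs acc T F' k
        else propagate rs (r :: acc) T F k
    else propagate rs acc T F k

/-- Collect the masks that are disjoint from `T`. -/
def filterDisjoint : List ℕ → List ℕ → ℕ → (List ℕ → Bool) → Bool
  | [], acc, _, k => k acc
  | t :: ts, acc, T, k =>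
    bif Nat.beq (Nat.land t T) 0 then filterDisjoint ts (t :: acc) T k
    else filterDisjoint ts acc T k

/-- Whether some mask in the list is contained in `F`. -/
def anyCovered (F : ℕ) : List ℕ → Bool
  | [] => false
  | t :: ts => bif Nat.beq (Nat.lor t F) F then true else anyCovered F ts

/-- Search for a set that is closed under the implications `rs`, contains `T`, avoids `F` and meets
all of the masks in `ms`, branching on the one-element masks in `vs`; the value is `true` if it is
found that there is none. -/
def search : ℕ → List (ℕ × ℕ) → List ℕ → List ℕ → ℕ → ℕ → Bool
  | 0, _, _, _, _, _ => false
  | fuel + 1, rs, vs, ms, T, F =>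
    propagate rs [] T F fun rs T F =>
      bif Nat.beq (Nat.land T F) 0 then
        filterDisjoint ms [] T fun ms =>
          -- The masks are the failure sets of models. If one lies inside `F`, every set on this
          -- branch is contained in that model, so the branch is finished; masks meeting `T` can no
          -- longer help and were removed.
          bif anyCovered F ms then true
          else
            match vs.dropWhile fun v => !Nat.beq (Nat.land v (Nat.lor T F)) 0 with
            -- With nothing left to branch on, repeated propagation may still close the branch; fuel
            -- bounds the repetition.
            | [] => search fuel rs [] ms T F
            | v :: vs =>
              -- Testing here that `v` has at most one bit spares any hypothesis on the branching
              -- list.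
              bif Nat.beq (Nat.land v (Nat.sub v 1)) 0 then
                (force (Nat.lor T v) fun T' => search fuel rs vs ms T' F) &&
                  force (Nat.lor F v) fun F' => search fuel rs vs ms T F'
              else false
      else true

/-- Evaluate the numerals in the list, omitting some duplicates. -/
def forcePairs : List (ℕ × ℕ) → List (ℕ × ℕ) → (List (ℕ × ℕ) → Bool) → Bool
  | [], acc, k => k acc
  | r :: rs, acc, k =>
    force r.1 fun a =>
      bif (acc.take 23).any fun s => Nat.beq s.1 a then forcePairs rs acc k
      else force r.2 fun b => forcePairs rs ((a, b) :: acc) k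

/-- Evaluate the numerals in the list that are not disjoint from `m`, omitting some duplicates. -/
def forceList (m : ℕ) : List ℕ → List ℕ → (List ℕ → Bool) → Bool
  | [], acc, k => k acc
  | t :: ts, acc, k =>
    force t fun a =>
      bif Nat.beq (Nat.land a m) 0 then forceList m ts acc k
      else bif (acc.take 23).any fun s => Nat.beq s a then forceList m ts acc k
      else forceList m ts (a :: acc) k

theorem force_eq (n : ℕ) (f : ℕ → Bool) : force n f = f n := by cases n <;> rfl

variable {p : ℕ → Prop}

/-- The elements of the mask belong to the set `p`. -/
def Present (p : ℕ → Prop) (m : ℕ) : Prop := ∀ n, m.testBit n = true → p n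

/-- The elements of the mask do not belong to the set `p`. -/
def Absent (p : ℕ → Prop) (m : ℕ) : Prop := ∀ n, m.testBit n = true → ¬ p n

/-- The set `p` is closed under the implications in the list. -/
def ClosedUnder (p : ℕ → Prop) (rs : List (ℕ × ℕ)) : Prop :=
  ∀ r ∈ rs, Present p r.1 → Present p r.2

theorem testBit_land (a b n : ℕ) : (Nat.land a b).testBit n = (a.testBit n && b.testBit n) :=
  Nat.testBit_and a b n

theorem testBit_lor (a b n : ℕ) : (Nat.lor a b).testBit n = (a.testBit n || b.testBit n) :=
  Nat.testBit_or a b n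

theorem testBit_nat_xor (a b n : ℕ) :
    (Nat.xor a b).testBit n = ((a.testBit n) ^^ (b.testBit n)) :=
  Nat.testBit_xor a b n

theorem Present.lor {a b : ℕ} (ha : Present p a) (hb : Present p b) : Present p (Nat.lor a b) := by
  intro n hn
  rw [testBit_lor, Bool.or_eq_true] at hn
  exact hn.elim (ha n) (hb n)

theorem Absent.lor {a b : ℕ} (ha : Absent p a) (hb : Absent p b) : Absent p (Nat.lor a b) := by
  intro n hn
  rw [testBit_lor, Bool.or_eq_true] at hn
  exact hn.elim (ha n) (hb n)

theorem testBit_of_lor_eq {a b n : ℕ} (h : Nat.beq (Nat.lor a b) b = true)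
    (ha : a.testBit n = true) : b.testBit n = true := by
  rw [← Nat.eq_of_beq_eq_true h, testBit_lor, ha, Bool.true_or]

theorem exists_testBit_of_land_ne {a b : ℕ} (h : Nat.beq (Nat.land a b) 0 = false) :
    ∃ n, a.testBit n = true ∧ b.testBit n = true := by
  obtain ⟨n, hn⟩ := Nat.exists_testBit_of_ne_zero (Nat.ne_of_beq_eq_false h)
  exact ⟨n, by rwa [testBit_land, Bool.and_eq_true] at hn⟩

theorem testBit_unique {d n k : ℕ} (h : Nat.beq (Nat.land d (Nat.sub d 1)) 0 = true)
    (hn : d.testBit n = true) (hk : d.testBit k = true) : n = k := by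
  have hd : d ≠ 0 := by rintro rfl; simp at hn
  obtain ⟨l, rfl⟩ := (Nat.and_sub_one_eq_zero_iff_isPowerOfTwo hd).mp (Nat.eq_of_beq_eq_true h)
  rw [Nat.testBit_two_pow, decide_eq_true_eq] at hn hk
  exact hn.symm.trans hk

theorem propagate_sound {k : List (ℕ × ℕ) → ℕ → ℕ → Bool} (rs : List (ℕ × ℕ)) :
    ∀ {acc : List (ℕ × ℕ)} {T F : ℕ}, propagate rs acc T F k = true → ClosedUnder p rs →
      ClosedUnder p acc → Present p T → Absent p F →
      ∃ rs' T' F', ClosedUnder p rs' ∧ Present p T' ∧ Absent p F' ∧ k rs' T' F' = true := by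
  induction rs with
  | nil => exact fun h _ hacc hT hF => ⟨_, _, _, hacc, hT, hF, h⟩
  | cons r rs ih =>
    intro acc T F h hrs hacc hT hF
    have hr := hrs r List.mem_cons_self
    have hrs' : ClosedUnder p rs := fun s hs => hrs s (List.mem_cons_of_mem _ hs)
    have hacc' : ClosedUnder p (r :: acc) := List.forall_mem_cons.mpr ⟨hr, hacc⟩
    rw [propagate] at h
    cases h1 : Nat.beq (Nat.land r.1 F) 0 <;> simp only [h1, cond_true, cond_false] at h
    · exact ih h hrs' hacc hT hF
    cases h2 : Nat.beq (Nat.lor r.1 T) T <;> simp only [h2, cond_true, cond_false] at h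
    · cases h3 : Nat.beq (Nat.land r.2 F) 0 <;> simp only [h3, cond_true, cond_false] at h
      · rw [force_eq] at h
        generalize hd : Nat.xor (Nat.lor r.1 T) T = d at h
        cases h4 : Nat.beq (Nat.land d (Nat.sub d 1)) 0 <;>
          simp only [h4, cond_true, cond_false] at h
        · exact ih h hrs' hacc' hT hF
        · rw [force_eq] at h
          -- If the one missing premise belonged to `p`, the rule would fire and put into `p` an
          -- element of `F`.
          refine ih h hrs' hacc hT (hF.lor fun n hn hpn => ?_)
          obtain ⟨l, hl1, hl2⟩ := exists_testBit_of_land_ne h3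
          refine hF l hl2 (hr (fun j hj => ?_) l hl1)
          cases hTj : T.testBit j
          · have : d.testBit j = true := by
              rw [← hd, testBit_nat_xor, testBit_lor, hj, hTj]; rfl
            exact testBit_unique h4 hn this ▸ hpn
          · exact hT j hTj
      · exact ih h hrs' hacc' hT hF
    · rw [force_eq] at h
      exact ih h hrs' hacc (hT.lor (hr fun n hn => hT n (testBit_of_lor_eq h2 hn))) hF

theorem filterDisjoint_sound {k : List ℕ → Bool} {T : ℕ} (ts : List ℕ) :
    ∀ {acc : List ℕ}, filterDisjoint ts acc T k = true →
      ∃ l, (∀ t ∈ l, t ∈ ts ∨ t ∈ acc) ∧ k l = true := by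
  induction ts with
  | nil => exact fun h => ⟨_, fun _ ht => Or.inr ht, h⟩
  | cons t ts ih =>
    intro acc h
    rw [filterDisjoint] at h
    cases h1 : Nat.beq (Nat.land t T) 0 <;> simp only [h1, cond_true, cond_false] at h <;>
    · obtain ⟨l, hl, hk⟩ := ih h
      refine ⟨l, fun s hs => ?_, hk⟩
      have := hl s hs
      simp only [List.mem_cons] at this ⊢
      tauto

theorem anyCovered_sound {F : ℕ} (ts : List ℕ) (h : anyCovered F ts = true) (hF : Absent p F) :
    ∃ t ∈ ts, Absent p t := by
  induction ts with
  | nil => exact absurd h (by simp [anyCovered])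
  | cons t ts ih =>
    rw [anyCovered] at h
    cases h1 : Nat.beq (Nat.lor t F) F <;> simp only [h1, cond_true, cond_false] at h
    · obtain ⟨s, hs, hps⟩ := ih h
      exact ⟨s, List.mem_cons_of_mem _ hs, hps⟩
    · exact ⟨t, List.mem_cons_self, fun n hn => hF n (testBit_of_lor_eq h1 hn)⟩

/-- The value `true` arises only from a contradiction between `T` and `F`, from a covered mask, or
from success on both branches; exhausted fuel gives `false`. Hence neither the fuel nor the
branching order matters for correctness. -/
theorem search_sound (fuel : ℕ) : ∀ {rs : List (ℕ × ℕ)} {vs ms : List ℕ} {T F : ℕ},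
    search fuel rs vs ms T F = true → ClosedUnder p rs → Present p T → Absent p F →
      ∃ t ∈ ms, Absent p t := by
  induction fuel with
  | zero => exact fun h => absurd h (by simp [search])
  | succ fuel ih =>
    intro rs vs ms T F h hrs hT hF
    rw [search] at h
    obtain ⟨rs, T, F, hrs, hT, hF, h⟩ := propagate_sound rs h hrs (by simp [ClosedUnder]) hT hF
    cases h1 : Nat.beq (Nat.land T F) 0 <;> simp only [h1, cond_true, cond_false] at h
    · obtain ⟨n, h1, h2⟩ := exists_testBit_of_land_ne h1
      exact absurd (hT n h1) (hF n h2)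
    obtain ⟨l, hl, h⟩ := filterDisjoint_sound ms h
    suffices ∃ t ∈ l, Absent p t by
      obtain ⟨t, ht, hpt⟩ := this
      exact ⟨t, (hl t ht).resolve_right List.not_mem_nil, hpt⟩
    cases h2 : anyCovered F l <;> simp only [h2, cond_true, cond_false] at h
    · split at h
      · exact ih h hrs hT hF
      · rename_i v vs _
        cases h3 : Nat.beq (Nat.land v (Nat.sub v 1)) 0 <;>
          simp only [h3, cond_true, cond_false, Bool.false_eq_true] at h
        rw [force_eq, force_eq, Bool.and_eq_true] at h
        by_cases hv : Present p v
        · exact ih h.1 hrs (hT.lor hv) hF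
        · refine ih h.2 hrs hT (hF.lor fun n hn hpn => hv fun k hk => ?_)
          exact testBit_unique h3 hn hk ▸ hpn
    · exact anyCovered_sound l h2 hF

/-- Only premises are compared when duplicates are dropped, so a rule with a different conclusion
may be lost. This is harmless: fewer rules only make the search harder, and all that is needed is
that every surviving rule was in the input. -/
theorem forcePairs_sound {k : List (ℕ × ℕ) → Bool} (rs : List (ℕ × ℕ)) :
    ∀ {acc : List (ℕ × ℕ)}, forcePairs rs acc k = true →
      ∃ l, (∀ r ∈ l, r ∈ rs ∨ r ∈ acc) ∧ k l = true := by
  induction rs with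
  | nil => exact fun h => ⟨_, fun _ hr => Or.inr hr, h⟩
  | cons r rs ih =>
    intro acc h
    rw [forcePairs, force_eq, force_eq] at h
    cases h1 : (acc.take 23).any fun s => Nat.beq s.1 r.1 <;>
      simp only [h1, cond_true, cond_false] at h <;>
    · obtain ⟨l, hl, hk⟩ := ih h
      refine ⟨l, fun s hs => ?_, hk⟩
      have := hl s hs
      simp only [List.mem_cons] at this ⊢
      tauto

theorem forceList_sound {k : List ℕ → Bool} {m : ℕ} (ts : List ℕ) :
    ∀ {acc : List ℕ}, forceList m ts acc k = true →
      ∃ l, (∀ t ∈ l, t ∈ ts ∧ Nat.beq (Nat.land t m) 0 = false ∨ t ∈ acc) ∧ k l = true := by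
  induction ts with
  | nil => exact fun h => ⟨_, fun _ ht => Or.inr ht, h⟩
  | cons t ts ih =>
    intro acc h
    rw [forceList, force_eq] at h
    cases h1 : Nat.beq (Nat.land t m) 0 <;> simp only [h1, cond_true, cond_false] at h
    · cases h2 : (acc.take 23).any fun s => Nat.beq s t <;>
        simp only [h2, cond_true, cond_false] at h <;>
      · obtain ⟨l, hl, hk⟩ := ih h
        refine ⟨l, fun s hs => ?_, hk⟩
        rcases hl s hs with ⟨h3, h4⟩ | h3
        · exact Or.inl ⟨List.mem_cons_of_mem _ h3, h4⟩
        · first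
            | exact Or.inr h3
            | rcases List.mem_cons.mp h3 with rfl | h3
              · exact Or.inl ⟨List.mem_cons_self, h1⟩
              · exact Or.inr h3
    · obtain ⟨l, hl, hk⟩ := ih h
      exact ⟨l, fun s hs => (hl s hs).imp_left fun h => ⟨List.mem_cons_of_mem _ h.1, h.2⟩, hk⟩

end Search

end GaussianCI

namespace GaussianCI

/-! ### Rules, models and the computation. -/

section Data

/-- The data of a couple: lists of the elements of the two sets. -/
abbrev CoupleData : Type := List (Fin 4) × List (Fin 4)

/-- The data of the couple `ij|C`. -/
def cd (i j : Fin 4) (C : List (Fin 4)) : CoupleData := ([i, j], C)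

/-- The bit mask of the set of elements of a list. -/
def bits (l : List (Fin 4)) : ℕ := l.foldr (fun i n => Nat.lor (Nat.pow 2 i.val) n) 0

/-- The bit masks of the two sets, joined to one number. -/
def CoupleData.pairCode (d : CoupleData) : ℕ := Nat.add (Nat.mul 16 (bits d.1)) (bits d.2)

/-- The numbers `CoupleData.pairCode d` of all couples, in an order that suits the search. -/
def pairCodes : List ℕ :=
  [48, 52, 56, 60, 80, 82, 88, 90, 144, 146, 148, 150, 96, 97, 104, 105, 160, 161, 164, 165,
   192, 193, 194, 195]

/-- The position of the couple in the list of all couples. -/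
def CoupleData.code (d : CoupleData) : ℕ :=
  pairCodes.findIdx (Nat.beq d.pairCode)

/-- Apply a map to the indices. -/
def CoupleData.map (f : Fin 4 → Fin 4) (d : CoupleData) : CoupleData := (d.1.map f, d.2.map f)

/-- The dual couple. -/
def CoupleData.dual (d : CoupleData) : CoupleData :=
  (d.1, [0, 1, 2, 3].filter fun x => x ∉ d.1 ++ d.2)

/-- The mask of the set of the codes of the couples in a list. -/
def mask (l : List CoupleData) : ℕ := l.foldr (fun d n => Nat.lor (Nat.pow 2 d.code) n) 0

/-- The general implications for the indices `1, 2, 3, 4`. -/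
def generalData : List (List CoupleData × List CoupleData) :=
  [([cd 1 2 [], cd 1 3 []], [cd 1 2 [3], cd 1 3 [2]]),
   ([cd 1 2 [], cd 1 3 [2]], [cd 1 3 [], cd 1 2 [3]]),
   ([cd 1 2 [3], cd 1 3 [2]], [cd 1 2 [], cd 1 3 []]),
   ([cd 1 2 [4], cd 1 3 [4]], [cd 1 2 [3, 4], cd 1 3 [2, 4]]),
   ([cd 1 2 [4], cd 1 3 [2, 4]], [cd 1 3 [4], cd 1 2 [3, 4]]),
   ([cd 1 2 [3, 4], cd 1 3 [2, 4]], [cd 1 2 [4], cd 1 3 [4]]),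
   ([cd 1 2 [], cd 3 4 [], cd 1 3 [2, 4], cd 2 4 [1, 3]], [cd 1 3 []]),
   ([cd 1 2 [], cd 3 4 [1], cd 3 4 [2], cd 1 2 [3, 4]], [cd 3 4 []]),
   ([cd 1 2 [], cd 2 4 [3], cd 3 4 [1], cd 1 3 [2, 4]], [cd 1 3 []]),
   ([cd 1 2 [3], cd 1 3 [4], cd 1 4 [2]], [cd 1 2 []]),
   ([cd 1 2 [3], cd 2 3 [4], cd 3 4 [1], cd 1 4 [2]], [cd 1 2 []])]

/-- The special implications. -/
def specialData : List (List CoupleData × List CoupleData) :=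
  [([cd 2 3 [4], cd 2 3 [1, 4], cd 2 4 [1], cd 3 4 [1]],
    [cd 2 3 [], cd 2 3 [1], cd 2 4 [1, 3], cd 3 4 [1, 2]]),
   ([cd 2 3 [], cd 2 3 [1], cd 2 4 [1], cd 3 4 [1]],
    [cd 2 3 [4], cd 2 3 [1, 4], cd 2 4 [1, 3], cd 3 4 [1, 2]]),
   ([cd 1 4 [2], cd 1 4 [3], cd 1 4 [2, 3], cd 2 3 [1, 4]], [cd 1 4 []]),
   ([cd 1 4 [], cd 1 4 [2], cd 1 4 [2, 3], cd 2 3 [1, 4]], [cd 1 4 [3]]),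
   ([cd 1 4 [], cd 1 4 [2], cd 1 4 [3], cd 2 3 [1, 4]], [cd 1 4 [2, 3]]),
   ([cd 1 4 [], cd 1 4 [2, 3], cd 2 3 [1], cd 2 3 [1, 4]], [cd 1 4 [2], cd 1 4 [3]]),
   ([cd 1 4 [2], cd 1 4 [3], cd 2 3 [1], cd 2 3 [1, 4]], [cd 1 4 [], cd 1 4 [2, 3]]),
   ([cd 1 2 [], cd 1 4 [3], cd 1 4 [2, 3], cd 2 3 [1, 4]],
    [cd 1 2 [3], cd 1 2 [4], cd 1 2 [3, 4], cd 2 3 [4]]),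
   ([cd 1 2 [], cd 1 4 [3], cd 2 3 [4], cd 2 3 [1, 4]],
    [cd 1 2 [3], cd 1 2 [4], cd 1 2 [3, 4], cd 1 4 [2, 3]]),
   ([cd 1 2 [3], cd 1 4 [2], cd 2 3 [4], cd 2 3 [1, 4]],
    [cd 1 2 [], cd 1 2 [4], cd 1 2 [3, 4], cd 1 4 []]),
   ([cd 1 2 [3], cd 1 4 [], cd 1 4 [2], cd 2 3 [1, 4]],
    [cd 1 2 [], cd 1 2 [4], cd 1 2 [3, 4], cd 2 3 [4]]),
   ([cd 1 4 [2], cd 2 3 [1], cd 2 3 [4], cd 2 3 [1, 4]], [cd 2 3 []]),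
   ([cd 1 4 [2], cd 2 3 [], cd 2 3 [1], cd 2 3 [1, 4]], [cd 2 3 [4]])]

/-- The data of all couples on four indices. -/
def coupleData : List CoupleData :=
  [cd 1 2 [], cd 1 2 [3], cd 1 2 [4], cd 1 2 [3, 4], cd 1 3 [], cd 1 3 [2], cd 1 3 [4],
   cd 1 3 [2, 4], cd 2 3 [], cd 2 3 [1], cd 2 3 [4], cd 2 3 [1, 4], cd 1 4 [], cd 1 4 [2],
   cd 1 4 [3], cd 1 4 [2, 3], cd 2 4 [], cd 2 4 [1], cd 2 4 [3], cd 2 4 [1, 3], cd 3 4 [],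
   cd 3 4 [1], cd 3 4 [2], cd 3 4 [1, 2]]

/-- A unit upper triangular integer matrix. -/
def unitri (a b c d e f : ℤ) : Matrix (Fin 4) (Fin 4) ℤ :=
  !![1, a, b, c; 0, 1, d, e; 0, 0, 1, f; 0, 0, 0, 1]

/-- The Gram matrix of the columns of `unitri a b c d e f`. -/
def gram (a b c d e f : ℤ) : Matrix (Fin 4) (Fin 4) ℤ :=
  !![1, a, b, c; a, a * a + 1, a * b + d, a * c + e; b, a * b + d, b * b + d * d + 1,
    b * c + d * e + f; c, a * c + e, b * c + d * e + f, c * c + e * e + f * f + 1]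

/-- Gram matrices that realize all the irreducible conditional independence structures, up to
permutation and duality. -/
def gramData : List (Matrix (Fin 4) (Fin 4) ℤ) :=
  [gram 0 0 0 0 0 (-1), gram 0 0 0 0 (-1) (-1), gram 0 (-1) 0 0 (-1) (-1),
   gram (-1) 0 (-1) 0 0 (-1), gram (-1) 0 0 (-1) (-1) 0, gram 0 (-1) 0 1 (-1) (-2),
   gram 1 1 (-1) 0 (-1) (-1), gram 0 1 (-1) (-1) (-1) 0, gram 1 (-1) (-1) 0 (-1) (-1),
   gram 1 0 (-1) (-1) (-2) 0, gram (-1) 0 (-1) (-1) (-1) 0, gram 1 0 (-1) (-1) 0 (-1),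
   gram (-1) (-1) 0 0 (-1) (-2), gram (-1) 0 (-1) (-1) 0 (-2), gram (-1) 1 (-1) (-1) 0 (-2),
   gram 1 (-1) 0 0 (-1) (-1)]

/-- The almost-principal determinant of an integer matrix. -/
def apDetInt (A : Matrix (Fin 4) (Fin 4) ℤ) : CoupleData → ℤ
  | ([i, j], []) => A i j
  | ([i, j], [k]) => A i j * A k k - A i k * A k j
  | ([i, j], [k, l]) => A i j * A k k * A l l - A i j * A k l * A l k - A i k * A k j * A l l +
      A i k * A k l * A l j + A i l * A k j * A l k - A i l * A k k * A l j
  | _ => 0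

/-- The couples that do not hold for a matrix. -/
def dependences (A : Matrix (Fin 4) (Fin 4) ℤ) : List CoupleData :=
  coupleData.filter fun d => apDetInt A d ≠ 0

/-- The permutations of the four indices. -/
def perms : List (Fin 4 → Fin 4) :=
  [0, 1, 2, 3].flatMap fun a => [0, 1, 2, 3].flatMap fun b => [0, 1, 2, 3].flatMap fun c =>
    [0, 1, 2, 3].flatMap fun d =>
      if [a, b, c, d].Nodup then [fun x : Fin 4 => [a, b, c, d].getD x 0] else []

/-- The masks of an implication and of its images under the permutations. -/
def orbitMasks (r : List CoupleData × List CoupleData) : List (ℕ × ℕ) :=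
  perms.map fun σ => (mask (r.1.map (·.map σ)), mask (r.2.map (·.map σ)))

/-- The masks of the duals of an implication and of its images under the permutations. -/
def dualOrbitMasks (r : List CoupleData × List CoupleData) : List (ℕ × ℕ) :=
  perms.map fun σ => (mask (r.1.map fun d => (d.map σ).dual),
    mask (r.2.map fun d => (d.map σ).dual))

/-- The masks of the listed implications. -/
def ruleMasks : List (ℕ × ℕ) :=
  generalData.flatMap orbitMasks ++ (specialData.flatMap orbitMasks ++
    specialData.flatMap dualOrbitMasks)

/-- The masks of the sets of couples that do not hold in the realized structures. -/
def modelMasks : List ℕ :=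
  gramData.flatMap fun A =>
    (perms.map fun σ => mask ((dependences A).map (·.map σ))) ++
      perms.map fun σ => mask ((dependences A).map fun d => (d.map σ).dual)

/-- Representatives of the couples up to permutation. -/
def targets : List CoupleData := [cd 1 2 [], cd 1 2 [3], cd 1 2 [3, 4]]

/-- For every couple in the list `targets`, every closed set that does not contain it is contained
in a realized structure that does not contain it. -/
def checkTargets : Bool :=
  forcePairs ruleMasks [] fun rs =>
    forceList (2 ^ 24 - 1) modelMasks [] fun ms =>
      -- `forceList` reverses its input, so the branching order is that of `coupleData`. The mask `2
      -- ^ 24 - 1` covers all couples and removes only the zero mask.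
      forceList (2 ^ 24 - 1) (coupleData.reverse.map fun d => 2 ^ d.code) [] fun vs =>
        targets.all fun d => force (2 ^ d.code) fun m =>
          -- Only models in which the target fails are kept; the search starts with the target
          -- excluded and nothing else known.
          forceList m ms [] fun ms => search 50 rs vs ms 0 m

/-- All the combinatorial content of completeness is in this evaluation. -/
theorem checkTargets_eq_true : checkTargets = true := by decide +kernel

end Data

end GaussianCI

namespace GaussianCI

open Matrix

/-! ### From bit masks back to couples. -/

section Link

/-- The couple with the given data. -/
def CoupleData.toCouple (d : CoupleData) : Couple 4 := (d.1.toFinset, d.2.toFinset)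

/-- The relation with the given data. -/
def toRelation (l : List CoupleData) : Relation 4 := (l.map CoupleData.toCouple).toFinset

theorem mem_toRelation {l : List CoupleData} {c : Couple 4} :
    c ∈ toRelation l ↔ ∃ d ∈ l, d.toCouple = c := by
  simp [toRelation]

theorem toRelation_subset {l : List CoupleData} {M : Relation 4} :
    toRelation l ⊆ M ↔ ∀ d ∈ l, d.toCouple ∈ M := by
  simp only [Finset.subset_iff, mem_toRelation, forall_exists_index, and_imp,
    forall_apply_eq_imp_iff₂]

theorem toCouple_map (σ : Equiv.Perm (Fin 4)) (d : CoupleData) :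
    (d.map σ).toCouple = d.toCouple.permute σ := by
  refine Prod.ext (Finset.ext fun x => ?_) (Finset.ext fun x => ?_) <;>
    simp [CoupleData.toCouple, CoupleData.map, Couple.permute]

theorem toCouple_dual (d : CoupleData) : d.dual.toCouple = d.toCouple.dual := by
  have h : ∀ x : Fin 4, x ∈ [(0 : Fin 4), 1, 2, 3] := by decide
  refine Prod.ext rfl (Finset.ext fun x => ?_)
  simp only [CoupleData.toCouple, CoupleData.dual, Couple.dual, List.mem_toFinset, List.mem_filter,
    h, true_and, decide_eq_true_eq, List.mem_append, Finset.mem_compl, Finset.mem_union]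

theorem toRelation_map_eq_image {g : CoupleData → CoupleData} {f : Couple 4 → Couple 4}
    (h : ∀ d, (g d).toCouple = f d.toCouple) (l : List CoupleData) :
    toRelation (l.map g) = (toRelation l).image f := by
  ext c
  simp only [toRelation, List.map_map, List.mem_toFinset, List.mem_map, Finset.mem_image,
    Function.comp_apply, h, exists_exists_and_eq_and]

theorem toRelation_map (σ : Equiv.Perm (Fin 4)) (l : List CoupleData) :
    toRelation (l.map (·.map σ)) = (toRelation l).permute σ :=
  toRelation_map_eq_image (toCouple_map σ) l

theorem toRelation_map_dual (σ : Equiv.Perm (Fin 4)) (l : List CoupleData) :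
    toRelation (l.map fun d => (d.map σ).dual) = ((toRelation l).permute σ).dual := by
  rw [Relation.dual, permute_eq_image, Finset.image_image]
  exact toRelation_map_eq_image (fun d => by rw [toCouple_dual, toCouple_map]; rfl) l

theorem testBit_bits {l : List (Fin 4)} {n : ℕ} :
    (bits l).testBit n = true ↔ ∃ i ∈ l, i.val = n := by
  induction l with
  | nil => simp [bits]
  | cons i l ih =>
    have : bits (i :: l) = Nat.lor (2 ^ i.val) (bits l) := rfl
    rw [this, testBit_lor, Bool.or_eq_true, ih, Nat.testBit_two_pow]
    simp

theorem bits_eq_iff {l l' : List (Fin 4)} : bits l = bits l' ↔ l.toFinset = l'.toFinset := by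
  have key : ∀ {l : List (Fin 4)} {i : Fin 4}, (bits l).testBit i = true ↔ i ∈ l.toFinset := by
    intro l i
    simp [testBit_bits, Fin.val_inj]
  constructor
  · intro h
    ext i
    rw [← key, ← key, h]
  · intro h
    refine Nat.eq_of_testBit_eq fun n => Bool.eq_iff_iff.mpr ?_
    rw [testBit_bits, testBit_bits]
    simp only [← List.mem_toFinset, h]

theorem bits_lt (l : List (Fin 4)) : bits l < 16 := by
  refine Nat.lt_pow_two_of_testBit (n := 4) _ fun i hi => ?_
  by_contra h
  rw [Bool.not_eq_false, testBit_bits] at h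
  obtain ⟨j, -, rfl⟩ := h
  omega

theorem pairCode_eq_iff {d d' : CoupleData} :
    d.pairCode = d'.pairCode ↔ d.toCouple = d'.toCouple := by
  have h : d.pairCode = d'.pairCode ↔ bits d.1 = bits d'.1 ∧ bits d.2 = bits d'.2 := by
    have h1 := bits_lt d.2
    have h2 := bits_lt d'.2
    simp only [CoupleData.pairCode, Nat.add_eq, Nat.mul_eq]
    omega
  rw [h, bits_eq_iff, bits_eq_iff, CoupleData.toCouple, CoupleData.toCouple, Prod.mk.injEq]

theorem exists_coupleData : ∀ c ∈ couples 4, ∃ d ∈ coupleData, d.toCouple = c := by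
  decide +kernel

theorem pairCode_mem_of_mem_coupleData : ∀ d ∈ coupleData, d.pairCode ∈ pairCodes := by
  decide +kernel

theorem pairCode_mem {d : CoupleData} (hd : d.toCouple ∈ couples 4) : d.pairCode ∈ pairCodes := by
  obtain ⟨d', hd', h⟩ := exists_coupleData _ hd
  rw [← pairCode_eq_iff.mpr h]
  exact pairCode_mem_of_mem_coupleData d' hd'

/-- `findIdx` returns the length of the list for anything that is not a couple, so codes separate
only genuine couples; there `pairCodes` recovers `pairCode` from the code. -/
theorem toCouple_eq_of_code_eq {d d' : CoupleData} (hd : d.toCouple ∈ couples 4)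
    (hd' : d'.toCouple ∈ couples 4) (h : d.code = d'.code) : d.toCouple = d'.toCouple := by
  have key : ∀ {d : CoupleData}, d.toCouple ∈ couples 4 → pairCodes[d.code]? = some d.pairCode := by
    intro d hd
    have hlt : d.code < pairCodes.length :=
      List.findIdx_lt_length_of_exists ⟨_, pairCode_mem hd, Nat.beq_refl _⟩
    have := List.findIdx_getElem (w := hlt)
    rw [List.getElem?_eq_getElem hlt, Nat.eq_of_beq_eq_true this]
    rfl
  have h1 := key hd
  rw [h, key hd', Option.some_inj] at h1
  exact pairCode_eq_iff.mp h1.symm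

theorem testBit_mask {l : List CoupleData} {n : ℕ} :
    (mask l).testBit n = true ↔ ∃ d ∈ l, d.code = n := by
  induction l with
  | nil => simp [mask]
  | cons d l ih =>
    have : mask (d :: l) = Nat.lor (2 ^ d.code) (mask l) := rfl
    rw [this, testBit_lor, Bool.or_eq_true, ih, Nat.testBit_two_pow]
    simp

/-- The set of the codes of the couples in a relation. -/
def HasCode (M : Relation 4) (n : ℕ) : Prop := ∃ d : CoupleData, d.code = n ∧ d.toCouple ∈ M

theorem hasCode_code {M : Relation 4} (hM : M ⊆ couples 4) {d : CoupleData}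
    (hd : d.toCouple ∈ couples 4) : HasCode M d.code ↔ d.toCouple ∈ M := by
  refine ⟨?_, fun h => ⟨d, rfl, h⟩⟩
  rintro ⟨d', h, h'⟩
  rwa [← toCouple_eq_of_code_eq (hM h') hd h]

theorem present_mask {M : Relation 4} {l : List CoupleData} (h : toRelation l ⊆ M) :
    Present (HasCode M) (mask l) := by
  intro n hn
  obtain ⟨d, hd, rfl⟩ := testBit_mask.mp hn
  exact ⟨d, rfl, toRelation_subset.mp h d hd⟩

theorem toRelation_subset_of_present {M : Relation 4} (hM : M ⊆ couples 4) {l : List CoupleData}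
    (hl : toRelation l ⊆ couples 4) (h : Present (HasCode M) (mask l)) : toRelation l ⊆ M :=
  toRelation_subset.mpr fun d hd => (hasCode_code hM (toRelation_subset.mp hl d hd)).mp
    (h _ (testBit_mask.mpr ⟨d, hd, rfl⟩))

end Link

/-! ### The rule masks come from listed implications. -/

section ListedData

theorem permute_insert {m : ℕ} (σ : Equiv.Perm (Fin m)) (c : Couple m) (L : Relation m) :
    Relation.permute σ (insert c L) = insert (c.permute σ) (L.permute σ) :=
  Finset.image_insert _ _ _

theorem permute_singleton {m : ℕ} (σ : Equiv.Perm (Fin m)) (c : Couple m) :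
    Relation.permute σ {c} = {c.permute σ} :=
  Finset.image_singleton _ _

theorem General.permute {m : ℕ} {K K' : Relation m} (h : General K K') (σ : Equiv.Perm (Fin m)) :
    General (K.permute σ) (K'.permute σ) := by
  have disj : ∀ {s C : Finset (Fin m)}, Disjoint s C → Disjoint (s.image σ) (C.image σ) :=
    (Finset.disjoint_image σ.injective).mpr
  cases h with
  | union i j k C hd hC =>
    have hC := disj hC
    simp only [Finset.image_insert, Finset.image_singleton] at hC
    simpa only [permute_insert, permute_singleton, permute_cpl, Finset.image_union,
      Finset.image_insert, Finset.image_singleton] using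
      General.union (σ i) (σ j) (σ k) _ (hd.map σ.injective) hC
  | contraction i j k C hd hC =>
    have hC := disj hC
    simp only [Finset.image_insert, Finset.image_singleton] at hC
    simpa only [permute_insert, permute_singleton, permute_cpl, Finset.image_union,
      Finset.image_insert, Finset.image_singleton] using
      General.contraction (σ i) (σ j) (σ k) _ (hd.map σ.injective) hC
  | intersection i j k C hd hC =>
    have hC := disj hC
    simp only [Finset.image_insert, Finset.image_singleton] at hC
    simpa only [permute_insert, permute_singleton, permute_cpl, Finset.image_union,
      Finset.image_insert, Finset.image_singleton] using
      General.intersection (σ i) (σ j) (σ k) _ (hd.map σ.injective) hC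
  | more1 i j k l C hd hC =>
    have hC := disj hC
    simp only [Finset.image_insert, Finset.image_singleton] at hC
    simpa only [permute_insert, permute_singleton, permute_cpl, Finset.image_union,
      Finset.image_insert, Finset.image_singleton] using
      General.more1 (σ i) (σ j) (σ k) (σ l) _ (hd.map σ.injective) hC
  | more2 i j k l C hd hC =>
    have hC := disj hC
    simp only [Finset.image_insert, Finset.image_singleton] at hC
    simpa only [permute_insert, permute_singleton, permute_cpl, Finset.image_union,
      Finset.image_insert, Finset.image_singleton] using
      General.more2 (σ i) (σ j) (σ k) (σ l) _ (hd.map σ.injective) hC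
  | more3 i j k l C hd hC =>
    have hC := disj hC
    simp only [Finset.image_insert, Finset.image_singleton] at hC
    simpa only [permute_insert, permute_singleton, permute_cpl, Finset.image_union,
      Finset.image_insert, Finset.image_singleton] using
      General.more3 (σ i) (σ j) (σ k) (σ l) _ (hd.map σ.injective) hC
  | more4 i j k l C hd hC =>
    have hC := disj hC
    simp only [Finset.image_insert, Finset.image_singleton] at hC
    simpa only [permute_insert, permute_singleton, permute_cpl, Finset.image_union,
      Finset.image_insert, Finset.image_singleton] using
      General.more4 (σ i) (σ j) (σ k) (σ l) _ (hd.map σ.injective) hC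
  | more5 i j k l C hd hC =>
    have hC := disj hC
    simp only [Finset.image_insert, Finset.image_singleton] at hC
    simpa only [permute_insert, permute_singleton, permute_cpl, Finset.image_union,
      Finset.image_insert, Finset.image_singleton] using
      General.more5 (σ i) (σ j) (σ k) (σ l) _ (hd.map σ.injective) hC

theorem permute_permute {m : ℕ} (σ τ : Equiv.Perm (Fin m)) (L : Relation m) :
    (L.permute σ).permute τ = L.permute (σ.trans τ) := by
  simp [Relation.permute, Finset.image_image, Function.comp_def]

theorem dual_permute {m : ℕ} (σ : Equiv.Perm (Fin m)) (L : Relation m) :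
    L.dual.permute σ = (L.permute σ).dual := by
  simp only [Relation.dual, permute_eq_image, Finset.image_image]
  refine Finset.image_congr fun c _ => Prod.ext rfl ?_
  simp only [Function.comp_apply, Couple.permute, Couple.dual]
  rw [← Finset.image_union]
  ext x
  obtain ⟨y, rfl⟩ := σ.surjective x
  simp

/-- Needed to move a closed relation by a permutation and so to reduce to the three targets.
Dualizing commutes with permuting, hence the dual family is stable too. -/
theorem Listed.permute {K K' : Relation 4} (h : Listed K K') (σ : Equiv.Perm (Fin 4)) :
    Listed (K.permute σ) (K'.permute σ) := by
  cases h with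
  | general h => exact .general (h.permute σ)
  | special τ h =>
    rw [permute_permute, permute_permute]
    exact .special _ h
  | dualSpecial τ h =>
    rw [dual_permute, dual_permute, permute_permute, permute_permute]
    exact .dualSpecial _ h

theorem General.congr {m : ℕ} {K K' L L' : Relation m} (h : General K K') (hL : L = K)
    (hL' : L' = K') : General L L' := hL ▸ hL' ▸ h

theorem general_of_mem_generalData :
    ∀ r ∈ generalData, General (toRelation r.1) (toRelation r.2) := by
  simp only [generalData, List.forall_mem_cons, List.not_mem_nil, false_imp_iff, implies_true,
    and_true]
  refine ⟨(General.union 1 2 3 ∅ ?_ ?_).congr ?_ ?_,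
    (General.contraction 1 2 3 ∅ ?_ ?_).congr ?_ ?_,
    (General.intersection 1 2 3 ∅ ?_ ?_).congr ?_ ?_, (General.union 1 2 3 {4} ?_ ?_).congr ?_ ?_,
    (General.contraction 1 2 3 {4} ?_ ?_).congr ?_ ?_,
    (General.intersection 1 2 3 {4} ?_ ?_).congr ?_ ?_,
    (General.more1 1 2 3 4 ∅ ?_ ?_).congr ?_ ?_, (General.more2 1 2 3 4 ∅ ?_ ?_).congr ?_ ?_,
    (General.more3 1 2 3 4 ∅ ?_ ?_).congr ?_ ?_, (General.more4 1 2 3 4 ∅ ?_ ?_).congr ?_ ?_,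
    (General.more5 1 2 3 4 ∅ ?_ ?_).congr ?_ ?_⟩ <;>
  decide

theorem special_of_mem_specialData :
    ∀ r ∈ specialData, Special (toRelation r.1) (toRelation r.2) := by
  simp only [specialData, List.forall_mem_cons, List.not_mem_nil, false_imp_iff, implies_true,
    and_true]
  exact ⟨.s1, .s2, .s3, .s4, .s5, .s6, .s7, .s8, .s9, .s10, .s11, .s12, .s13⟩

theorem bijective_of_mem_perms : ∀ f ∈ perms, Function.Bijective f := by
  decide +kernel

/-- The permutation of the indices given by an element of the list. -/
theorem exists_perm_of_mem_perms {f : Fin 4 → Fin 4} (hf : f ∈ perms) :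
    ∃ σ : Equiv.Perm (Fin 4), f = σ :=
  ⟨Equiv.ofBijective f (bijective_of_mem_perms f hf), rfl⟩

theorem exists_listed_of_mem_ruleMasks {r : ℕ × ℕ} (hr : r ∈ ruleMasks) :
    ∃ a b, r = (mask a, mask b) ∧ Listed (toRelation a) (toRelation b) := by
  simp only [ruleMasks, List.mem_append, List.mem_flatMap, orbitMasks, dualOrbitMasks,
    List.mem_map] at hr
  obtain ⟨s, hs, f, hf, rfl⟩ | ⟨s, hs, f, hf, rfl⟩ | ⟨s, hs, f, hf, rfl⟩ := hr <;>
    obtain ⟨σ, rfl⟩ := exists_perm_of_mem_perms hf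
  · refine ⟨_, _, rfl, ?_⟩
    rw [toRelation_map, toRelation_map]
    exact .general ((general_of_mem_generalData s hs).permute σ)
  · refine ⟨_, _, rfl, ?_⟩
    rw [toRelation_map, toRelation_map]
    exact .special σ (special_of_mem_specialData s hs)
  · refine ⟨_, _, rfl, ?_⟩
    rw [toRelation_map_dual, toRelation_map_dual]
    exact .dualSpecial σ (special_of_mem_specialData s hs)

/-- The relation is closed under the listed implications. -/
def IsClosed (M : Relation 4) : Prop := ∀ K K', Listed K K' → K ⊆ M → K' ⊆ M

theorem closedUnder_ruleMasks {M : Relation 4} (hM : M ⊆ couples 4) (h : IsClosed M) :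
    ClosedUnder (HasCode M) ruleMasks := by
  intro r hr
  obtain ⟨a, b, rfl, hab⟩ := exists_listed_of_mem_ruleMasks hr
  exact fun ha => present_mask (h _ _ hab
    (toRelation_subset_of_present hM (isImplication_of_listed hab).1 ha))

end ListedData

end GaussianCI

namespace GaussianCI

open Matrix

/-! ### Realization by Gram matrices and the completeness argument. -/

section Completeness

theorem gram_eq (a b c d e f : ℤ) :
    gram a b c d e f = (unitri a b c d e f)ᵀ * unitri a b c d e f := by
  ext i j
  fin_cases i <;> fin_cases j <;> simp [gram, unitri, mul_apply, Fin.sum_univ_four] <;> ring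

theorem det_unitri (a b c d e f : ℤ) : (unitri a b c d e f).det = 1 := by
  simp [unitri, det_succ_row_zero, Fin.sum_univ_succ]

/-- The matrix is UᵀU with U unimodular, hence invertible over the reals. -/
theorem posDef_gram (a b c d e f : ℤ) : ((gram a b c d e f).map (Int.cast : ℤ → ℝ)).PosDef := by
  set B := (unitri a b c d e f).map (Int.cast : ℤ → ℝ) with hB
  have hdet : B.det = 1 := by
    have := Int.cast_det (R := ℝ) (unitri a b c d e f)
    rw [det_unitri, Int.cast_one] at this
    exact this.symm
  have h : (gram a b c d e f).map (Int.cast : ℤ → ℝ) = Bᴴ * B := by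
    rw [gram_eq, conjTranspose_eq_transpose_of_trivial, hB, ← transpose_map]
    exact Matrix.map_mul (f := Int.castRingHom ℝ)
  rw [h]
  exact .conjTranspose_mul_self B (mulVec_injective_of_isUnit
    ((isUnit_iff_isUnit_det _).mpr (hdet ▸ isUnit_one)))

theorem posDef_of_mem_gramData {A : Matrix (Fin 4) (Fin 4) ℤ} (hA : A ∈ gramData) :
    (A.map (Int.cast : ℤ → ℝ)).PosDef := by
  revert A
  simp only [gramData, List.forall_mem_cons, List.not_mem_nil, false_imp_iff, implies_true,
    and_true, posDef_gram]

/-- Turns the conditional independences of a real matrix into equalities of integers, which the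
kernel can decide. -/
theorem holds_toCouple_iff {A : Matrix (Fin 4) (Fin 4) ℤ} (hA : (A.map (Int.cast : ℤ → ℝ)).PosDef) :
    ∀ d ∈ coupleData, Holds (A.map (Int.cast : ℤ → ℝ)) d.toCouple ↔ apDetInt A d = 0 := by
  have h0 : ∀ i j, Holds (A.map (Int.cast : ℤ → ℝ)) (CoupleData.toCouple (cd i j [])) ↔
      apDetInt A (cd i j []) = 0 := by
    intro i j
    rw [← Int.cast_inj (α := ℝ)]
    simpa [cpl, cd, apDetInt, CoupleData.toCouple, apDet_empty] using
      holds_cpl hA (i := i) (j := j) (C := ∅)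
  have h1 : ∀ i j k, Holds (A.map (Int.cast : ℤ → ℝ)) (CoupleData.toCouple (cd i j [k])) ↔
      apDetInt A (cd i j [k]) = 0 := by
    intro i j k
    rw [← Int.cast_inj (α := ℝ)]
    simpa [cpl, cd, apDetInt, CoupleData.toCouple, apDet_singleton] using
      holds_cpl hA (i := i) (j := j) (C := {k})
  have h2 : ∀ i j k l, k ≠ l →
      (Holds (A.map (Int.cast : ℤ → ℝ)) (CoupleData.toCouple (cd i j [k, l])) ↔
      apDetInt A (cd i j [k, l]) = 0) := by
    intro i j k l hkl
    rw [← Int.cast_inj (α := ℝ)]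
    simpa [cpl, cd, apDetInt, CoupleData.toCouple, apDet_pair _ _ _ hkl] using
      holds_cpl hA (i := i) (j := j) (C := {k, l})
  simp only [coupleData, List.forall_mem_cons, List.not_mem_nil, false_imp_iff, implies_true,
    and_true, h0, h1, true_and]
  refine ⟨?_, ?_, ?_, ?_, ?_, ?_⟩ <;> exact h2 _ _ _ _ (by decide)

/-- Some positive definite matrix satisfies precisely the couples that are not in `D`. -/
def Realizable (D : Relation 4) : Prop :=
  ∃ S : Matrix (Fin 4) (Fin 4) ℝ, S.PosDef ∧ ∀ c ∈ couples 4, Holds S c ↔ c ∉ D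

theorem permute_symm_permute {m : ℕ} (σ : Equiv.Perm (Fin m)) (c : Couple m) :
    (c.permute σ.symm).permute σ = c := by
  simp [Couple.permute, Finset.image_image]

theorem Realizable.permute {D : Relation 4} (h : Realizable D) (σ : Equiv.Perm (Fin 4)) :
    Realizable (D.permute σ) := by
  obtain ⟨S, hS, h⟩ := h
  refine ⟨S.submatrix σ.symm σ.symm, hS.submatrix σ.symm.injective, fun c hc => ?_⟩
  have hc' := permute_symm_permute σ c
  rw [← holds_permute, h _ (permute_mem_couples.mpr hc), permute_eq_image]
  nth_rw 2 [← hc']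
  rw [(permute_injective σ).mem_finset_image]

theorem Realizable.dual {D : Relation 4} (h : Realizable D) (hD : D ⊆ couples 4) :
    Realizable D.dual := by
  obtain ⟨S, hS, h⟩ := h
  refine ⟨S⁻¹, hS.inv, fun c hc => ?_⟩
  rw [← dual_dual hc, holds_dual hS (dual_mem_couples hc), h _ (dual_mem_couples hc), not_iff_not]
  refine ⟨Finset.mem_image_of_mem _, fun hm => ?_⟩
  obtain ⟨c', hc', e⟩ := Finset.mem_image.mp hm
  rw [dual_dual hc] at e
  rwa [← e, dual_dual (hD hc')]

theorem toCouple_mem_couples : ∀ d ∈ coupleData, d.toCouple ∈ couples 4 := by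
  decide +kernel

theorem toRelation_dependences_subset (A : Matrix (Fin 4) (Fin 4) ℤ) :
    toRelation (dependences A) ⊆ couples 4 :=
  toRelation_subset.mpr fun d hd => toCouple_mem_couples d (List.mem_filter.mp hd).1

theorem realizable_dependences {A : Matrix (Fin 4) (Fin 4) ℤ} (hA : A ∈ gramData) :
    Realizable (toRelation (dependences A)) := by
  have hS := posDef_of_mem_gramData hA
  have key := holds_toCouple_iff hS
  refine ⟨_, hS, fun c hc => ⟨fun h hm => ?_, fun h => ?_⟩⟩
  · obtain ⟨d, hd, rfl⟩ := mem_toRelation.mp hm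
    obtain ⟨hd, hne⟩ := List.mem_filter.mp hd
    exact of_decide_eq_true hne ((key d hd).mp h)
  · obtain ⟨d, hd, rfl⟩ := exists_coupleData c hc
    by_contra hn
    exact h (mem_toRelation.mpr ⟨d, List.mem_filter.mpr
      ⟨hd, decide_eq_true fun h => hn ((key d hd).mpr h)⟩, rfl⟩)

theorem permute_subset_couples {m : ℕ} {L : Relation m} (h : L ⊆ couples m)
    (σ : Equiv.Perm (Fin m)) : L.permute σ ⊆ couples m := by
  rw [permute_eq_image, Finset.image_subset_iff]
  exact fun c hc => permute_mem_couples.mpr (h hc)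

theorem dual_subset_couples {m : ℕ} {L : Relation m} (h : L ⊆ couples m) :
    L.dual ⊆ couples m := by
  rw [Relation.dual, Finset.image_subset_iff]
  exact fun c hc => dual_mem_couples (h hc)

theorem exists_realizable_of_mem_modelMasks {t : ℕ} (ht : t ∈ modelMasks) :
    ∃ l, t = mask l ∧ toRelation l ⊆ couples 4 ∧ Realizable (toRelation l) := by
  simp only [modelMasks, List.mem_flatMap, List.mem_append, List.mem_map] at ht
  obtain ⟨A, hA, ⟨f, hf, rfl⟩ | ⟨f, hf, rfl⟩⟩ := ht <;>
    obtain ⟨σ, rfl⟩ := exists_perm_of_mem_perms hf <;>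
    have hc := permute_subset_couples (toRelation_dependences_subset A) σ
  · refine ⟨_, rfl, ?_, ?_⟩ <;> rw [toRelation_map]
    · exact hc
    · exact (realizable_dependences hA).permute σ
  · refine ⟨_, rfl, ?_, ?_⟩ <;> rw [toRelation_map_dual]
    · exact dual_subset_couples hc
    · exact ((realizable_dependences hA).permute σ).dual hc

theorem toCouple_mem_couples_of_mem_targets : ∀ d ∈ targets, d.toCouple ∈ couples 4 := by
  decide +kernel

/-- The search yields the failure set of a realized structure that is disjoint from `M` and contains
the target; the realizing matrix then satisfies all of `M` and violates the target. -/
theorem exists_mem_Vpd_of_mem_targets {M : Relation 4} (hM : M ⊆ couples 4) (h : IsClosed M)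
    {d : CoupleData} (hd : d ∈ targets) (hdM : d.toCouple ∉ M) :
    ∃ S ∈ Vpd M, ¬ Holds S d.toCouple := by
  have hdc := toCouple_mem_couples_of_mem_targets d hd
  obtain ⟨rs, hrs, h1⟩ := forcePairs_sound _ checkTargets_eq_true
  obtain ⟨ms, hms, h2⟩ := forceList_sound _ h1
  obtain ⟨vs, -, h3⟩ := forceList_sound _ h2
  have h4 := List.all_eq_true.mp h3 d hd
  rw [force_eq] at h4
  obtain ⟨ms', hms', h5⟩ := forceList_sound _ h4
  have hclosed : ClosedUnder (HasCode M) rs := fun r hr =>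
    closedUnder_ruleMasks hM h r ((hrs r hr).resolve_right List.not_mem_nil)
  have habs : Absent (HasCode M) (2 ^ d.code) := by
    intro n hn
    rw [Nat.testBit_two_pow, decide_eq_true_eq] at hn
    rwa [← hn, hasCode_code hM hdc]
  obtain ⟨t, ht, htM⟩ := search_sound 50 h5 hclosed (fun n hn => by simp at hn) habs
  obtain ⟨ht', hland⟩ := (hms' t ht).resolve_right List.not_mem_nil
  obtain ⟨l, rfl, hl, S, hS, hSl⟩ := exists_realizable_of_mem_modelMasks
    ((hms t ht').resolve_right List.not_mem_nil).1
  refine ⟨S, mem_Vpd.mpr ⟨hS, fun c hc => (hSl c (hM hc)).mpr fun hcl => ?_⟩, ?_⟩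
  · obtain ⟨d', hd', rfl⟩ := mem_toRelation.mp hcl
    exact htM _ (testBit_mask.mpr ⟨d', hd', rfl⟩) ⟨d', rfl, hc⟩
  · obtain ⟨n, hn, hn'⟩ := exists_testBit_of_land_ne hland
    obtain ⟨d', hd', rfl⟩ := testBit_mask.mp hn
    rw [Nat.testBit_two_pow, decide_eq_true_eq] at hn'
    have hl' := mem_toRelation.mpr ⟨d', hd', rfl⟩
    rw [hSl _ hdc, not_not, toCouple_eq_of_code_eq hdc (hl hl') hn']
    exact hl'

/-- Permutations act transitively on the couples with a given size of conditioning set, and the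
sizes are 0, 1, 2. -/
theorem exists_map_toCouple_eq :
    ∀ c ∈ couples 4, ∃ f ∈ perms, ∃ d ∈ targets, (d.map f).toCouple = c := by
  decide +kernel

theorem exists_mem_Vpd_not_holds {M : Relation 4} (hM : M ⊆ couples 4) (h : IsClosed M)
    {c : Couple 4} (hc : c ∈ couples 4) (hcM : c ∉ M) : ∃ S ∈ Vpd M, ¬ Holds S c := by
  obtain ⟨f, hf, d, hd, rfl⟩ := exists_map_toCouple_eq c hc
  obtain ⟨σ, rfl⟩ := exists_perm_of_mem_perms hf
  rw [toCouple_map] at hcM ⊢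
  -- The preimage of `M` under the permutation is again closed and avoids the target; the matrix
  -- found for it is then relabelled back.
  have hM' : ∀ {c}, c ∈ (couples 4).filter (fun c => c.permute σ ∈ M) ↔ c.permute σ ∈ M := by
    intro c
    rw [Finset.mem_filter, and_iff_right_of_imp fun h => permute_mem_couples.mp (hM h)]
  obtain ⟨S, hS, hSd⟩ := exists_mem_Vpd_of_mem_targets
    (M := (couples 4).filter fun c => c.permute σ ∈ M) (Finset.filter_subset _ _)
    (fun K K' hK hKM c hc => hM'.mpr (h _ _ (hK.permute σ)
      (Finset.image_subset_iff.mpr fun c hc => hM'.mp (hKM hc)) (Finset.mem_image_of_mem _ hc)))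
    hd (fun h => hcM (hM'.mp h))
  rw [mem_Vpd] at hS
  have hSσ : (S.submatrix σ.symm σ.symm).submatrix σ σ = S := by
    simp [submatrix_submatrix]
  refine ⟨S.submatrix σ.symm σ.symm, mem_Vpd.mpr
    ⟨hS.1.submatrix σ.symm.injective, fun c hc => ?_⟩, ?_⟩
  · have hc' := permute_symm_permute σ c
    rw [← hc', holds_permute, hSσ]
    exact hS.2 _ (hM'.mpr (by rwa [hc']))
  · rwa [holds_permute, hSσ]

theorem deducible_of_isImplication {L₁ L₂ : Relation 4} (h : IsImplication L₁ L₂) :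
    Deducible Listed L₁ L₂ := by
  classical
  obtain ⟨hL₁, hL₂, -, hV⟩ := h
  intro c hc
  by_contra hn
  have hM : ∀ {c}, c ∈ (couples 4).filter (Derivable Listed L₁) ↔
      c ∈ couples 4 ∧ Derivable Listed L₁ c := Finset.mem_filter
  -- The derivable couples form a closed relation, so a couple of `L₂` that is not derivable is
  -- violated by a matrix satisfying all derivable ones, in particular all of `L₁`.
  obtain ⟨S, hS, hSc⟩ := exists_mem_Vpd_not_holds (Finset.filter_subset (Derivable Listed L₁) _)
    (fun K K' hK hKM c hc => hM.mpr ⟨(isImplication_of_listed hK).2.1 hc,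
      .step hK (fun c hc => (hM.mp (hKM hc)).2) hc⟩) (hL₂ hc) (fun h => hn (hM.mp h).2)
  obtain ⟨hpos, hS⟩ := mem_Vpd.mp hS
  have : S ∈ Vpd (L₁ ∪ L₂) :=
    hV ▸ mem_Vpd.mpr ⟨hpos, fun c hc => hS c (hM.mpr ⟨hL₁ hc, .hyp hc⟩)⟩
  exact hSc ((mem_Vpd.mp this).2 c (Finset.mem_union_right _ hc))

end Completeness

end GaussianCI

theorem mainTheorem8 :
    (∀ K K' : GaussianCI.Relation 4,
      GaussianCI.Listed K K' → GaussianCI.IsImplication K K') ∧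
    (∀ L₁ L₂ : GaussianCI.Relation 4,
      GaussianCI.IsImplication L₁ L₂ → GaussianCI.Deducible GaussianCI.Listed L₁ L₂) :=
  ⟨fun _ _ h => GaussianCI.isImplication_of_listed h,
    fun _ _ h => GaussianCI.deducible_of_isImplication h⟩
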